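/- Let $d\ge 2$, $S^{d-1}_+=\{v\in\mathbb R^d:\|v\|=1,\ v_d>0\}$, $L_*=\{x\in\mathbb R^d: x_d=0\}$ and $B=L_*\times S^{d-1}_+$. Let $\nu_d$ be the Lambertian (Knudsen) law on $S^{d-1}_+$, that is, the probability measure with density $v\mapsto b_d\,v_d$ with respect to surface measure, where $b_d>0$ is the normalizing constant, and let $\Lambda$ be the product on $B$ of Lebesgue measure on $L_*$ and $\nu_d$. For each $n\ge 1$ let $M_n\subset\{x\in\mathbb R^d: x_d\le 0\}$ be a set whose intersection with every ball is a finite union of pieces of smooth hypersurfaces. For $(x,v)\in B$ consider the point particle that starts from $x$ at time $0$ with velocity $-v$, moves along straight segments in $\{x_d<0\}$, and is reflected specularly whenever it hits $M_n$ (reflections are only defined at points near which $M_n$ is a smooth hypersurface, for a non-tangential velocity). Suppose that for $\Lambda$-almost every $(x,v)$ the particle returns to $L_*$ after a finite number of such reflections, and let $K_n:B\to B$ be a measurable map such that for $\Lambda$-almost every $(x,v)$, $K_n(x,v)=(y,w)$, where $y\in L_*$ is the place of the first return to $L_*$ at a positive time and $w\in S^{d-1}_+$ is the velocity at that time. Let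 $\mathbb P_{K_n}(x,v;dy,dw)=\delta_{K_n(x,v)}(dy,dw)$ be the corresponding deterministic Markov kernel on $B$. A sequence of measures $\mu_n$ is said to converge weakly to $\mu_\infty$ on a topological space $\Gamma$ if there are measurable sets $\Gamma_j$, $j\ge 1$, with $\bigcup_j\Gamma_j=\Gamma$, $\mu_n(\Gamma_j)<\infty$ and $\mu_\infty(\Gamma_j)<\infty$ for all $n$ and $j$, such that for every $j$ the finite measures $\mu_n|_{\Gamma_j}$ converge weakly to $\mu_\infty|_{\Gamma_j}$ as $n\to\infty$. Suppose that for some probability measure $\widetilde{\mathbb P}$ on $S^{d-1}_+$, $$\Lambda(dx,dv)\,\mathbb P_{K_n}(x,v;dy,dw)\ \longrightarrow\ \Lambda(dx,dv)\,\delta_x(dy)\,\widetilde{\mathbb P}(dw)$$ weakly on $B^2$ as $n\to\infty$. Then $\widetilde{\mathbb P}=\nu_d$. -/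

import Mathlib

open MeasureTheory ProbabilityTheory Filter Topology Set

namespace RoughReflection

/-- The ambient space `ℝ^d`, where `d = k + 1`. -/
abbrev Space (k : ℕ) := EuclideanSpace ℝ (Fin (k + 1))

/-- The hyperplane `L_* = {x ∈ ℝ^d : x_d = 0}`, parametrised by its first `d - 1 = k`
coordinates; see `Plane.incl` for the inclusion in `ℝ^d`. -/
abbrev Plane (k : ℕ) := EuclideanSpace ℝ (Fin k)

/-- The inclusion `(x_1, …, x_{d-1}) ↦ (x_1, …, x_{d-1}, 0)` of `L_*` in `ℝ^d`. -/
noncomputable def Plane.incl {k : ℕ} (x : Plane k) : Space k :=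
  WithLp.toLp 2 (Fin.snoc (α := fun _ => ℝ) x.ofLp 0)

/-- The last coordinate `x_d = ⟨x, 𝐧⟩` with `𝐧 = (0, …, 0, 1)`. -/
def height {k : ℕ} (x : Space k) : ℝ := x (Fin.last k)

/-- The open upper half-sphere `S^{d-1}_+ = {v ∈ S^{d-1} : v_d > 0}`. -/
abbrev HalfSphere (k : ℕ) := {v : Metric.sphere (0 : Space k) 1 // 0 < height (v : Space k)}

/-- A point of the half-sphere as a vector of `ℝ^d`. -/
def HalfSphere.vec {k : ℕ} (v : HalfSphere k) : Space k := v.1.1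

/-- The usual surface measure on `S^{d-1}_+`. -/
noncomputable def surfaceMeasure (k : ℕ) : Measure (HalfSphere k) :=
  ((volume : Measure (Space k)).toSphere).comap Subtype.val

/-- The normalizing constant `b_d` of the Knudsen law. -/
noncomputable def knudsenConst (k : ℕ) : ℝ :=
  (∫ v, height (HalfSphere.vec v) ∂(surfaceMeasure k))⁻¹

/-- The Lambertian (Knudsen) law `ν_d` on `S^{d-1}_+`, with density `b_d ⟨v, 𝐧⟩` with respect to
surface measure. -/
noncomputable def knudsen (k : ℕ) : Measure (HalfSphere k) :=
  (surfaceMeasure k).withDensity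
    (fun v => ENNReal.ofReal (knudsenConst k * height (HalfSphere.vec v)))

/-- The phase space `B = L_* × S^{d-1}_+`. -/
abbrev Phase (k : ℕ) := Plane k × HalfSphere k

/-- The measure `Λ` on `B`: the product of Lebesgue measure and `ν_d`. -/
noncomputable def Lam (k : ℕ) : Measure (Phase k) :=
  (volume : Measure (Plane k)).prod (knudsen k)

theorem continuous_height_vec (k : ℕ) :
    Continuous (fun v : HalfSphere k => height (HalfSphere.vec v)) := by
  unfold height HalfSphere.vec
  fun_prop

instance (k : ℕ) : IsFiniteMeasure (surfaceMeasure k) := by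
  unfold surfaceMeasure
  infer_instance

theorem measurableSet_halfSphere (k : ℕ) :
    MeasurableSet {v : Metric.sphere (0 : Space k) 1 | 0 < height (v : Space k)} := by
  refine (isOpen_lt continuous_const ?_).measurableSet
  unfold height
  fun_prop

theorem integrable_height (k : ℕ) :
    Integrable (fun v => height (HalfSphere.vec v)) (surfaceMeasure k) := by
  refine Integrable.of_bound (continuous_height_vec k).aestronglyMeasurable 1
    (Eventually.of_forall fun v => ?_)
  have h := PiLp.norm_apply_le (p := 2) (v.1.1) (Fin.last k)
  have h1 : ‖(v.1.1 : Space k)‖ = 1 := by simp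
  rw [h1] at h
  exact h

theorem surfaceMeasure_ne_zero (k : ℕ) : surfaceMeasure k ≠ 0 := by
  intro h0
  have hopen : IsOpen {v : Metric.sphere (0 : Space k) 1 | 0 < height (v : Space k)} := by
    refine isOpen_lt continuous_const ?_
    unfold height
    fun_prop
  have hne : {v : Metric.sphere (0 : Space k) 1 | 0 < height (v : Space k)}.Nonempty :=
    ⟨⟨EuclideanSpace.single (Fin.last k) 1, by simp⟩, by simp [height]⟩
  refine hopen.measure_ne_zero (volume : Measure (Space k)).toSphere hne ?_
  have h1 : surfaceMeasure k univ = 0 := by simp [h0]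
  unfold surfaceMeasure at h1
  have he : MeasurableEmbedding (Subtype.val : HalfSphere k → Metric.sphere (0 : Space k) 1) :=
    MeasurableEmbedding.subtype_coe (measurableSet_halfSphere k)
  rw [he.comap_apply, image_univ,
    Subtype.range_coe_subtype] at h1
  exact h1

theorem integral_height_pos (k : ℕ) :
    0 < ∫ v, height (HalfSphere.vec v) ∂(surfaceMeasure k) := by
  rw [integral_pos_iff_support_of_nonneg (fun v => v.2.le) (integrable_height k)]
  have h : Function.support (fun v : HalfSphere k => height (HalfSphere.vec v)) = univ :=
    eq_univ_of_forall fun v => ne_of_gt v.2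
  rw [h, pos_iff_ne_zero, Ne, Measure.measure_univ_eq_zero]
  exact surfaceMeasure_ne_zero k

instance (k : ℕ) : IsProbabilityMeasure (knudsen k) := by
  constructor
  rw [knudsen, withDensity_apply _ MeasurableSet.univ, Measure.restrict_univ, knudsenConst,
    ← ofReal_integral_eq_lintegral_ofReal ((integrable_height k).const_mul _)
      (Eventually.of_forall fun v =>
        mul_nonneg (inv_nonneg.2 (integral_height_pos k).le) v.2.le),
    integral_const_mul, inv_mul_cancel₀ (integral_height_pos k).ne',
    ENNReal.ofReal_one]

instance (k : ℕ) : SigmaFinite (Lam k) := by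
  unfold Lam
  infer_instance

/-- The point `q` of `M` is regular and `n` is a unit normal to `M` at `q`: in a neighbourhood
of `q` the set `M` is the zero set of a smooth function whose gradient at `q` is the unit vector
`n`. -/
def IsUnitNormal {k : ℕ} (M : Set (Space k)) (q n : Space k) : Prop :=
  q ∈ M ∧ ‖n‖ = 1 ∧ ∃ U : Set (Space k), IsOpen U ∧ q ∈ U ∧ ∃ φ : Space k → ℝ,
    ContDiffOn ℝ (⊤ : ℕ∞) φ U ∧ M ∩ U = {z ∈ U | φ z = 0} ∧ HasGradientAt φ n q

/-- A smooth embedded hypersurface of `ℝ^d` (without boundary, not necessarily closed). -/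
def IsSmoothHypersurface {k : ℕ} (T : Set (Space k)) : Prop :=
  ∀ q ∈ T, ∃ n, IsUnitNormal T q n

/-- A piece of a smooth hypersurface; it may have edges and corners. -/
def IsSmoothPiece {k : ℕ} (S : Set (Space k)) : Prop :=
  ∃ T, IsSmoothHypersurface T ∧ S ⊆ T

/-- A rough surface: a subset `M` of `{x_d ≤ 0}` whose intersection with every ball is the union
of a finite number of smooth pieces. -/
structure IsRoughSurface {k : ℕ} (M : Set (Space k)) : Prop where
  height_nonpos : ∀ q ∈ M, height q ≤ 0
  finite_pieces : ∀ (c : Space k) (r : ℝ), ∃ 𝒮 : Set (Set (Space k)), 𝒮.Finite ∧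
    (∀ S ∈ 𝒮, IsSmoothPiece S) ∧ M ∩ Metric.closedBall c r = ⋃₀ 𝒮

/-- A free flight of duration `t` from `z` with velocity `u`: strictly between the times `0` and
`t` the particle neither meets `M` nor leaves the region `{x_d < 0}`. -/
def FreeFlight {k : ℕ} (M : Set (Space k)) (z u : Space k) (t : ℝ) : Prop :=
  0 < t ∧ ∀ s ∈ Ioo 0 t, z + s • u ∉ M ∧ height (z + s • u) < 0

/-- `ReturnsTo M z u y w`: the trajectory that leaves `z` with velocity `u` makes a finite number
of specular reflections (at regular points of `M`, not tangentially), stays in `{x_d < 0}`, and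
then comes (back) to `L_*` for the first time, at the point `y` and with the velocity `w`. -/
inductive ReturnsTo {k : ℕ} (M : Set (Space k)) : Space k → Space k → Space k → Space k → Prop
  | arrive (z u : Space k) (t : ℝ) (hfree : FreeFlight M z u t)
      (hy : height (z + t • u) = 0) : ReturnsTo M z u (z + t • u) u
  | reflect (z u : Space k) (t : ℝ) (n y w : Space k) (hfree : FreeFlight M z u t)
      (hq : height (z + t • u) < 0) (hn : IsUnitNormal M (z + t • u) n)
      (htrans : inner ℝ u n ≠ 0)
      (hrest : ReturnsTo M (z + t • u) (u - (2 * inner ℝ u n) • n) y w) : ReturnsTo M z u y w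

/-- `K : B → B` is the transformation induced by `M`: for `Λ`-almost every `(x, v)`, the
trajectory that starts from `x` with velocity `-v` returns to `L_*` after a finite number of
reflections, and `K (x, v) = (y, w)` is its place and velocity at the first return. -/
def IsReflectionMap {k : ℕ} (M : Set (Space k)) (K : Phase k → Phase k) : Prop :=
  ∀ᵐ p ∂(Lam k), ReturnsTo M (Plane.incl p.1) (-HalfSphere.vec p.2)
    (Plane.incl (K p).1) (HalfSphere.vec (K p).2)

/-- The Markov kernel `δ_x(dy) P(dw)` on `B`: the particle stays at `x` and its outgoing
direction has law `P`, whatever `x` and the incoming direction `v` are. -/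
noncomputable def memorylessKernel {k : ℕ} (P : Measure (HalfSphere k)) :
    Kernel (Phase k) (Phase k) :=
  (Kernel.deterministic Prod.fst measurable_fst) ×ₖ (Kernel.const (Phase k) P)

/-- Weak convergence of `σ`-finite measures: the space is covered by a sequence of sets that have
finite measure for all measures involved, on each of which the restrictions converge weakly. -/
def ConvergesWeakly {Γ : Type*} [TopologicalSpace Γ] [MeasurableSpace Γ]
    (μ : ℕ → Measure Γ) (μlim : Measure Γ) : Prop :=
  ∃ A : ℕ → Set Γ, (∀ j, MeasurableSet (A j)) ∧ ⋃ j, A j = univ ∧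
    (∀ j n, μ n (A j) < ⊤) ∧ (∀ j, μlim (A j) < ⊤) ∧
    ∀ j, ∀ f : BoundedContinuousFunction Γ ℝ,
      Tendsto (fun n => ∫ x, f x ∂((μ n).restrict (A j))) atTop
        (𝓝 (∫ x, f x ∂(μlim.restrict (A j))))

end RoughReflection

namespace RoughReflection

/-! The core is that every reflection map satisfies Λ(K⁻¹A) ≤ Λ(A) (`Lam_preimage_le`). The second
marginal of Λ ⊗ P_K is then at most Λ. Lower semicontinuity on open sets under weak convergence
(`ConvergesWeakly.measure_open_le_liminf`) passes this to the limit, so vol(V) P(U) ≤ vol(V) ν(U)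
for V the unit ball and U open. Outer regularity gives P ≤ ν, and two probability measures so
ordered are equal. Invariance of Λ is never needed, only the inequality.

For the inequality, a trajectory is seen as a chain of oriented lines. A line together with the
component t of a point along its direction is the same thing as a point-direction pair, and such
pairs carry the measure volume × sphere measure. Free flight does not change the line, and a
reflection changes the line but keeps t. In a patch of the mirror, the Jacobian from (surface point,
t) to space at a fixed direction u is unchanged, up to sign, when u is reflected, because the normal
is orthogonal to the surface (`abs_det_lineDeriv_mirror`). The sphere measure is also invariant, so
reflection locally preserves measure.

By the Lindelöf property, countably many such local maps cover all reflections, hence so do their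
compositions. Trajectories are reversible, so K is injective almost everywhere. Cutting its domain
into countably many pieces, each governed by one composition, and adding the measures of the
disjoint images gives the bound. This avoids studying regularity of the billiard map or its singular
set. The Knudsen law enters through the flux: lines of direction v crossing L_* fill volume
proportional to v_d (`Lam_prod_apply`). -/

/-! ### Specular reflection -/

/-- The image of `u` under the reflection in the hyperplane orthogonal to the unit vector `n`. -/
noncomputable def mirror {k : ℕ} (n u : Space k) : Space k := u - (2 * inner ℝ u n) • n

theorem mirror_neg_normal {k : ℕ} (n u : Space k) : mirror (-n) u = mirror n u := by
  simp [mirror]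

theorem mirror_neg {k : ℕ} (n u : Space k) : mirror n (-u) = -mirror n u := by
  simp only [mirror, inner_neg_left, mul_neg, neg_smul]; abel

theorem inner_mirror_normal {k : ℕ} {n : Space k} (hn : ‖n‖ = 1) (u : Space k) :
    inner ℝ (mirror n u) n = -inner ℝ u n := by
  rw [mirror, inner_sub_left, real_inner_smul_left, real_inner_self_eq_norm_sq, hn]; ring

theorem mirror_mirror {k : ℕ} {n : Space k} (hn : ‖n‖ = 1) (u : Space k) :
    mirror n (mirror n u) = u := by
  conv_lhs => rw [mirror, inner_mirror_normal hn, mirror]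
  module

theorem inner_mirror_mirror {k : ℕ} {n : Space k} (hn : ‖n‖ = 1) (u v : Space k) :
    inner ℝ (mirror n u) (mirror n v) = inner ℝ u v := by
  conv_lhs => rw [mirror, inner_sub_left, real_inner_smul_left, real_inner_comm (mirror n v) n,
    inner_mirror_normal hn, mirror, inner_sub_right, real_inner_smul_right]
  ring

theorem norm_mirror {k : ℕ} {n : Space k} (hn : ‖n‖ = 1) (u : Space k) : ‖mirror n u‖ = ‖u‖ := by
  have h := inner_mirror_mirror hn u u
  rw [real_inner_self_eq_norm_sq, real_inner_self_eq_norm_sq] at h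
  exact (sq_eq_sq₀ (norm_nonneg _) (norm_nonneg _)).1 h

/-- The reflection `mirror n` as a linear isometry equivalence. -/
noncomputable def mirrorEquiv {k : ℕ} (n : Space k) (hn : ‖n‖ = 1) : Space k ≃ₗᵢ[ℝ] Space k where
  toFun := mirror n
  invFun := mirror n
  left_inv := mirror_mirror hn
  right_inv := mirror_mirror hn
  map_add' u v := by simp only [mirror, inner_add_left]; module
  map_smul' c u := by simp only [mirror, real_inner_smul_left, RingHom.id_apply]; module
  norm_map' := norm_mirror hn

@[simp] theorem mirrorEquiv_apply {k : ℕ} (n : Space k) (hn : ‖n‖ = 1) (u : Space k) :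
    mirrorEquiv n hn u = mirror n u := rfl

/-! ### Uniqueness of the normal, determinism and reversibility -/

theorem height_add {k : ℕ} (x y : Space k) : height (x + y) = height x + height y := rfl

theorem height_smul {k : ℕ} (c : ℝ) (x : Space k) : height (c • x) = c * height x := rfl

theorem height_neg {k : ℕ} (x : Space k) : height (-x) = -height x := rfl

/-- Near `q` the second defining function vanishes on the zero set of the first, so `q` is a
constrained extremum. Lagrange multipliers make the two gradients proportional, and unit length
leaves only a sign. -/
theorem IsUnitNormal.eq_or_eq_neg {k : ℕ} {M : Set (Space k)} {q n n' : Space k}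
    (h : IsUnitNormal M q n) (h' : IsUnitNormal M q n') : n' = n ∨ n' = -n := by
  obtain ⟨hq, hn, U, hU, hqU, φ, hφ, hM, hg⟩ := h
  obtain ⟨-, hn', U', hU', hqU', ψ, hψ, hM', hg'⟩ := h'
  have hφq : φ q = 0 := (hM.subset ⟨hq, hqU⟩).2
  have hψq : ψ q = 0 := (hM'.subset ⟨hq, hqU'⟩).2
  have hs : HasStrictFDerivAt φ (InnerProductSpace.toDual ℝ _ n) q := by
    have := ((hφ.contDiffAt (hU.mem_nhds hqU)).hasStrictFDerivAt (by simp))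
    rwa [hg.hasFDerivAt.fderiv] at this
  have hs' : HasStrictFDerivAt ψ (InnerProductSpace.toDual ℝ _ n') q := by
    have := ((hψ.contDiffAt (hU'.mem_nhds hqU')).hasStrictFDerivAt (by simp))
    rwa [hg'.hasFDerivAt.fderiv] at this
  have hext : IsLocalExtrOn ψ {x | φ x = φ q} q := by
    left
    filter_upwards [self_mem_nhdsWithin, mem_nhdsWithin_of_mem_nhds (hU.mem_nhds hqU),
      mem_nhdsWithin_of_mem_nhds (hU'.mem_nhds hqU')] with x hx hxU hxU'
    have hxM : x ∈ M := (hM.superset ⟨hxU, by simpa [hφq] using hx⟩).1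
    rw [hψq, (hM'.subset ⟨hxM, hxU'⟩).2]
  obtain ⟨a, b, hab, hlin⟩ := hext.exists_multipliers_of_hasStrictFDerivAt_1d hs hs'
  have hlin' : a • n + b • n' = 0 := by
    apply (InnerProductSpace.toDual ℝ (Space k)).injective
    simpa using hlin
  have hb : b ≠ 0 := by
    rintro rfl
    have : n ≠ 0 := by rintro rfl; simp at hn
    simp_all
  have hn'n : n' = (-(b⁻¹ * a)) • n := by
    have h1 : b • n' = -(a • n) := by rw [eq_neg_iff_add_eq_zero, add_comm]; exact hlin'
    calc n' = b⁻¹ • b • n' := by rw [smul_smul, inv_mul_cancel₀ hb, one_smul]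
      _ = _ := by rw [h1]; module
  have hc : |(-(b⁻¹ * a))| = 1 := by
    have := congrArg norm hn'n
    rw [norm_smul, hn, hn', mul_one, Real.norm_eq_abs] at this
    exact this.symm
  rcases (abs_eq zero_le_one).1 hc with h1 | h1
  · left; rw [hn'n, h1, one_smul]
  · right; rw [hn'n, h1, neg_one_smul]

theorem IsUnitNormal.mirror_eq {k : ℕ} {M : Set (Space k)} {q n n' : Space k}
    (h : IsUnitNormal M q n) (h' : IsUnitNormal M q n') (u : Space k) :
    mirror n' u = mirror n u := by
  rcases h.eq_or_eq_neg h' with rfl | rfl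
  · rfl
  · exact mirror_neg_normal n u

theorem FreeFlight.reverse {k : ℕ} {M : Set (Space k)} {z u : Space k} {t : ℝ}
    (h : FreeFlight M z u t) : FreeFlight M (z + t • u) (-u) t := by
  refine ⟨h.1, fun s hs => ?_⟩
  have h1 : z + t • u + s • (-u) = z + (t - s) • u := by module
  rw [h1]
  exact h.2 _ ⟨by linarith [hs.2], by linarith [hs.1]⟩

/-- Determinism: the free-flight condition forbids any event before the first one, so two flights
from the same state have equal duration and the same type of end. The reflected velocity does not
depend on the choice of normal. -/
theorem ReturnsTo.unique {k : ℕ} {M : Set (Space k)} {z u y w : Space k}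
    (h : ReturnsTo M z u y w) : ∀ {y' w'}, ReturnsTo M z u y' w' → y' = y ∧ w' = w := by
  induction h with
  | arrive z u t hfree hy =>
    intro y' w' h'
    cases h' with
    | arrive _ _ t' hfree' hy' =>
      rcases lt_trichotomy t t' with h | rfl | h
      · exact absurd hy (hfree'.2 t ⟨hfree.1, h⟩).2.ne
      · exact ⟨rfl, rfl⟩
      · exact absurd hy' (hfree.2 t' ⟨hfree'.1, h⟩).2.ne
    | reflect _ _ t' n' _ _ hfree' hq' hn' htrans' hrest' =>
      rcases lt_trichotomy t t' with h | rfl | h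
      · exact absurd hy (hfree'.2 t ⟨hfree.1, h⟩).2.ne
      · exact absurd hy hq'.ne
      · exact absurd hn'.1 (hfree.2 t' ⟨hfree'.1, h⟩).1
  | reflect z u t n y w hfree hq hn htrans hrest ih =>
    intro y' w' h'
    cases h' with
    | arrive _ _ t' hfree' hy' =>
      rcases lt_trichotomy t' t with h | rfl | h
      · exact absurd hy' (hfree.2 t' ⟨hfree'.1, h⟩).2.ne
      · exact absurd hy' hq.ne
      · exact absurd hn.1 (hfree'.2 t ⟨hfree.1, h⟩).1
    | reflect _ _ t' n' _ _ hfree' hq' hn' htrans' hrest' =>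
      rcases lt_trichotomy t' t with h | rfl | h
      · exact absurd hn'.1 (hfree.2 t' ⟨hfree'.1, h⟩).1
      · have h1 := hn.mirror_eq hn' u
        simp only [mirror] at h1
        rw [h1] at hrest'
        exact ih hrest'
      · exact absurd hn.1 (hfree'.2 t ⟨hfree.1, h⟩).1

/-- The reversed trajectory meets the flights in the opposite order, so the part already reversed is
carried along the induction as a continuation: `H` says how to end at `(Z, V)` once the current
flight has been reversed. -/
theorem ReturnsTo.reverse_aux {k : ℕ} {M : Set (Space k)} {z u y w : Space k}
    (h : ReturnsTo M z u y w) (Z V : Space k)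
    (H : ∀ t, FreeFlight M (z + t • u) (-u) t → ReturnsTo M (z + t • u) (-u) Z V) :
    ReturnsTo M y (-w) Z V := by
  induction h with
  | arrive z u t hfree hy => exact H t hfree.reverse
  | reflect z u t n y w hfree hq hn htrans hrest ih =>
    refine ih fun s hs => ?_
    change ReturnsTo M (z + t • u + s • mirror n u) (-mirror n u) Z V
    have h1 : z + t • u + s • mirror n u + s • (-mirror n u) = z + t • u := by module
    refine ReturnsTo.reflect _ _ s n Z V hs ?_ ?_ ?_ ?_
    · rw [h1]; exact hq
    · rw [h1]; exact hn
    · rw [inner_neg_left, inner_mirror_normal hn.2.1, neg_neg]; exact htrans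
    · change ReturnsTo M _ (mirror n (-mirror n u)) Z V
      rw [h1, mirror_neg, mirror_mirror hn.2.1]
      exact H t hfree.reverse

theorem ReturnsTo.reverse {k : ℕ} {M : Set (Space k)} {z u y w : Space k}
    (h : ReturnsTo M z u y w) (hz : height z = 0) : ReturnsTo M y (-w) z (-u) := by
  refine h.reverse_aux z (-u) fun t ht => ?_
  have h1 : z + t • u + t • (-u) = z := by module
  have h2 := ReturnsTo.arrive _ _ t ht (by rw [h1]; exact hz)
  rwa [h1] at h2

/-- Both reversed trajectories start from `y` with velocity `-w`, so determinism identifies their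
ends. -/
theorem ReturnsTo.injective {k : ℕ} {M : Set (Space k)} {z u z' u' y w : Space k}
    (h : ReturnsTo M z u y w) (h' : ReturnsTo M z' u' y w) (hz : height z = 0)
    (hz' : height z' = 0) : z = z' ∧ u = u' := by
  have h1 := (h.reverse hz).unique (h'.reverse hz')
  exact ⟨h1.1.symm, (neg_injective h1.2).symm⟩

/-! ### The billiard as a succession of maps between oriented lines -/

/-- The point with parameter `t` of the line through `z` with unit direction `u`, together with
the direction; the parameter is the component of the point along `u`. -/
noncomputable def lineAt {k : ℕ} (z u : Space k) (t : ℝ) : Space k × Space k :=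
  (z + (t - inner ℝ z u) • u, u)

theorem lineAt_add_smul {k : ℕ} {u : Space k} (hu : ‖u‖ = 1) (z : Space k) (s t : ℝ) :
    lineAt (z + s • u) u t = lineAt z u t := by
  have h : inner ℝ (z + s • u) u = inner ℝ z u + s := by
    rw [inner_add_left, real_inner_smul_left, real_inner_self_eq_norm_sq, hu]; ring
  simp only [lineAt, h, Prod.mk.injEq, and_true]
  module

/-- The relation between a line and the reflected line at a regular point of `M`. -/
def Reflects {k : ℕ} (M : Set (Space k)) (a b : Space k × Space k) : Prop :=
  ∃ q n u : Space k, ∃ t : ℝ, IsUnitNormal M q n ∧ inner ℝ u n ≠ 0 ∧ ‖u‖ = 1 ∧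
    a = lineAt q u t ∧ b = lineAt q (mirror n u) t

/-- All information on visibility, order and timing of the collisions is dropped; what remains is a
chain of reflected lines with a common parameter `t`. -/
theorem ReturnsTo.reflTransGen {k : ℕ} {M : Set (Space k)} {z u y w : Space k}
    (h : ReturnsTo M z u y w) (hu : ‖u‖ = 1) (t : ℝ) :
    Relation.ReflTransGen (Reflects M) (lineAt z u t) (lineAt y w t) := by
  induction h with
  | arrive z u s hfree hy => rw [lineAt_add_smul hu]
  | reflect z u s n y w hfree hq hn htrans hrest ih =>
    refine Relation.ReflTransGen.head ?_ (ih ((norm_mirror hn.2.1 u).trans hu))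
    exact ⟨z + s • u, n, u, t, hn, htrans, hu, (lineAt_add_smul hu z s t).symm, rfl⟩

/-! ### Partial maps that do not increase measure -/

/-- The partial map `f` with domain `D` is measurable and maps `μ` to a measure below `μ`. -/
def IsSubpreservingOn {X : Type*} [MeasurableSpace X] (μ : Measure X) (f : X → X) (D : Set X) :
    Prop :=
  ∀ A, MeasurableSet A → MeasurableSet (D ∩ f ⁻¹' A) ∧ μ (D ∩ f ⁻¹' A) ≤ μ A

/-- The relation `r` is covered by the graphs of countably many partial maps that do not increase
the measure `μ`. -/
def CountablySubpreserving {X : Type*} [MeasurableSpace X] (μ : Measure X) (r : X → X → Prop) :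
    Prop :=
  ∃ S : Set ((X → X) × Set X), S.Countable ∧ (∀ g ∈ S, IsSubpreservingOn μ g.1 g.2) ∧
    ∀ a b, r a b → ∃ g ∈ S, a ∈ g.2 ∧ g.1 a = b

theorem IsSubpreservingOn.measurableSet {X : Type*} [MeasurableSpace X] {μ : Measure X}
    {f : X → X} {D : Set X} (h : IsSubpreservingOn μ f D) : MeasurableSet D := by
  simpa using (h univ MeasurableSet.univ).1

theorem IsSubpreservingOn.comp {X : Type*} [MeasurableSpace X] {μ : Measure X}
    {f g : X → X} {D E : Set X} (hg : IsSubpreservingOn μ g E) (hf : IsSubpreservingOn μ f D) :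
    IsSubpreservingOn μ (g ∘ f) (D ∩ f ⁻¹' E) := by
  intro A hA
  have h : D ∩ f ⁻¹' E ∩ (g ∘ f) ⁻¹' A = D ∩ f ⁻¹' (E ∩ g ⁻¹' A) := by
    rw [inter_assoc, preimage_inter, preimage_comp]
  rw [h]
  have h1 := hg A hA
  have h2 := hf _ h1.1
  exact ⟨h2.1, h2.2.trans h1.2⟩

/-- Finite compositions of members of a countable family are again countable in number, and
subpreservation is stable under composition. -/
theorem CountablySubpreserving.reflTransGen {X : Type*} [MeasurableSpace X] {μ : Measure X}
    {r : X → X → Prop} (h : CountablySubpreserving μ r) :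
    CountablySubpreserving μ (Relation.ReflTransGen r) := by
  obtain ⟨S, hS, hsub, hcov⟩ := h
  let step : Set ((X → X) × Set X) → Set ((X → X) × Set X) := fun 𝒯 =>
    image2 (fun g f => (g.1 ∘ f.1, f.2 ∩ f.1 ⁻¹' g.2)) S 𝒯
  let T : ℕ → Set ((X → X) × Set X) := fun m => step^[m] {(id, univ)}
  have hTs : ∀ m, T (m + 1) = step (T m) := fun m => Function.iterate_succ_apply' _ _ _
  have hTc : ∀ m, (T m).Countable := by
    intro m
    induction m with
    | zero => exact countable_singleton _
    | succ m ih => rw [hTs]; exact hS.image2 ih _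
  have hTsub : ∀ m, ∀ g ∈ T m, IsSubpreservingOn μ g.1 g.2 := by
    intro m
    induction m with
    | zero =>
      rintro g rfl
      intro A hA
      simpa using hA
    | succ m ih =>
      rw [hTs]
      rintro _ ⟨g, hg, f, hf, rfl⟩
      exact (hsub g hg).comp (ih f hf)
  refine ⟨⋃ m, T m, countable_iUnion hTc, ?_, ?_⟩
  · intro g hg
    obtain ⟨m, hm⟩ := mem_iUnion.1 hg
    exact hTsub m g hm
  · intro a b hab
    induction hab with
    | refl => exact ⟨(id, univ), mem_iUnion.2 ⟨0, rfl⟩, mem_univ _, rfl⟩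
    | tail _ hbc ih =>
      obtain ⟨f, hf, haf, rfl⟩ := ih
      obtain ⟨m, hm⟩ := mem_iUnion.1 hf
      obtain ⟨g, hg, hag, rfl⟩ := hcov _ _ hbc
      refine ⟨(g.1 ∘ f.1, f.2 ∩ f.1 ⁻¹' g.2), mem_iUnion.2 ⟨m + 1, ?_⟩, ⟨haf, hag⟩, rfl⟩
      rw [hTs]
      exact ⟨g, hg, f, hm, rfl⟩

/-- A measurable map `T` that is injective on a conull set and is, through the coordinates
`e ∘ T` and `j`, contained in a countably subpreserving relation, does not increase measure. -/
theorem measure_preimage_le_of_countablySubpreserving {X Y : Type*} [MeasurableSpace X]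
    [StandardBorelSpace X] [MeasurableSpace Y] [StandardBorelSpace Y] {μ : Measure X}
    {Λ : Measure Y} {r : X → X → Prop} (hr : CountablySubpreserving μ r) {e j : Y → X}
    (he : Measurable e) (hei : Function.Injective e) (hj : Measurable j)
    {c : ENNReal}
    (hce : ∀ C, MeasurableSet C → Λ C = c * μ (e '' C))
    (hcj : ∀ C, MeasurableSet C → Λ C = c * μ (j '' C)) {T : Y → Y} (hT : Measurable T)
    {G : Set Y} (hG : ∀ᵐ y ∂Λ, y ∈ G) (hTG : InjOn T G) (hrT : ∀ y ∈ G, r (j y) (e (T y)))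
    {A : Set Y} (hA : MeasurableSet A) : Λ (T ⁻¹' A) ≤ Λ A := by
  obtain ⟨S, hS, hsub, hcov⟩ := hr
  obtain ⟨G', hG'G, hG'm, hG'⟩ := exists_measurable_superset_of_null (show Λ Gᶜ = 0 from hG)
  have hGc : G'ᶜ ⊆ G := compl_subset_comm.1 hG'G
  have hle : Λ (T ⁻¹' A) ≤ Λ (T ⁻¹' A ∩ G'ᶜ) := by
    calc Λ (T ⁻¹' A) ≤ Λ (T ⁻¹' A ∩ G'ᶜ ∪ G') := measure_mono fun y hy => by
          by_cases h : y ∈ G'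
          · exact Or.inr h
          · exact Or.inl ⟨hy, h⟩
      _ ≤ _ := (measure_union_le _ _).trans (by rw [hG', add_zero])
  refine hle.trans ?_
  -- A nonempty countable family can be listed as a sequence; if the family is empty, the good set
  -- is empty too.
  rcases S.eq_empty_or_nonempty with rfl | hSne
  · have : T ⁻¹' A ∩ G'ᶜ = ∅ := by
      ext y
      simp only [mem_inter_iff, mem_empty_iff_false, iff_false, not_and]
      intro _ hy
      obtain ⟨g, hg, _⟩ := hcov _ _ (hrT y (hGc hy))
      exact hg
    rw [this, measure_empty]
    exact zero_le
  obtain ⟨g, rfl⟩ := hS.exists_eq_range hSne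
  have hsub' : ∀ i, IsSubpreservingOn μ (g i).1 (g i).2 := fun i => hsub _ ⟨i, rfl⟩
  -- the set where `T` agrees with the `i`-th partial map
  let E : ℕ → Set Y := fun i =>
    {y | j y ∈ (g i).2 ∧ (g i).1 (j y) = e (T y)} ∩ (T ⁻¹' A ∩ G'ᶜ)
  have hEm : ∀ i, MeasurableSet (E i) := by
    intro i
    refine MeasurableSet.inter ?_ ((hT hA).inter hG'm.compl)
    have hD : MeasurableSet (j ⁻¹' (g i).2) := hj (hsub' i).measurableSet
    have h1 : Measurable fun y : j ⁻¹' (g i).2 => (g i).1 (j y) := by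
      intro B hB
      have h2 := hj ((hsub' i) B hB).1
      refine ⟨_, h2, ?_⟩
      ext y
      simp only [mem_preimage, mem_inter_iff]
      exact ⟨fun h => h.2, fun h => ⟨y.2, h⟩⟩
    have h2 := hD.subtype_image (measurableSet_eq_fun h1 ((he.comp hT).comp measurable_subtype_coe))
    convert h2 using 1
    ext y
    simp [and_comm]
  have hcovE : T ⁻¹' A ∩ G'ᶜ ⊆ ⋃ i, disjointed E i := by
    rw [iUnion_disjointed]
    intro y hy
    obtain ⟨_, ⟨i, rfl⟩, h1, h2⟩ := hcov _ _ (hrT y (hGc hy.2))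
    exact mem_iUnion.2 ⟨i, ⟨h1, h2⟩, hy⟩
  have hdE : ∀ i, disjointed E i ⊆ E i := disjointed_subset E
  have hdm : ∀ i, MeasurableSet (disjointed E i) := fun i => MeasurableSet.disjointed hEm i
  have hinjE : ∀ i, InjOn T (disjointed E i) := fun i =>
    hTG.mono fun y hy => hGc (hdE i hy).2.2
  -- Lusin–Souslin: injective measurable images are measurable in standard Borel spaces.
  have hTm : ∀ i, MeasurableSet (T '' disjointed E i) := fun i =>
    (hdm i).image_of_measurable_injOn hT (hinjE i)
  -- On this piece `T` agrees with the `i`-th partial map, so the image under `j` lies in the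
  -- preimage under that map of the image under `e ∘ T`.
  have hpiece : ∀ i, Λ (disjointed E i) ≤ Λ (T '' disjointed E i) := by
    intro i
    rw [hcj _ (hdm i), hce _ (hTm i)]
    gcongr c * ?_
    have hm := (hTm i).image_of_measurable_injOn he hei.injOn
    refine (measure_mono ?_).trans ((hsub' i) _ hm).2
    rintro _ ⟨y, hy, rfl⟩
    have h1 := (hdE i hy).1
    exact ⟨h1.1, ⟨T y, ⟨y, hy, rfl⟩, h1.2.symm⟩⟩
  calc Λ (T ⁻¹' A ∩ G'ᶜ) ≤ Λ (⋃ i, disjointed E i) := measure_mono hcovE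
    _ ≤ ∑' i, Λ (disjointed E i) := measure_iUnion_le _
    _ ≤ ∑' i, Λ (T '' disjointed E i) := ENNReal.tsum_le_tsum hpiece
    _ = Λ (⋃ i, T '' disjointed E i) := by
        refine (measure_iUnion (fun i l hil => ?_) hTm).symm
        refine disjoint_left.2 ?_
        rintro _ ⟨y, hy, rfl⟩ ⟨y', hy', heq⟩
        have hyy : y' = y := hTG (hGc (hdE l hy').2.2) (hGc (hdE i hy).2.2) heq
        subst hyy
        exact disjoint_left.1 (disjoint_disjointed E hil) hy hy'
    _ ≤ Λ A := by
        refine measure_mono (iUnion_subset fun i => ?_)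
        rintro _ ⟨y, hy, rfl⟩
        exact (hdE i hy).2.1

/-! ### The measure on lines -/

/-- The surface measure of the unit sphere, as a measure on `ℝ^d`. -/
noncomputable def sphereMeasure (k : ℕ) : Measure (Space k) :=
  ((volume : Measure (Space k)).toSphere).map Subtype.val

instance (k : ℕ) : IsFiniteMeasure (sphereMeasure k) := by
  unfold sphereMeasure
  infer_instance

theorem sphereMeasure_apply {k : ℕ} {A : Set (Space k)} (hA : MeasurableSet A) :
    sphereMeasure k A = Module.finrank ℝ (Space k) *
      volume (image2 (fun (r : ℝ) (x : Space k) => r • x) (Ioo 0 1) (Metric.sphere 0 1 ∩ A)) := by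
  rw [sphereMeasure, Measure.map_apply measurable_subtype_coe hA,
    Measure.toSphere_apply' _ (measurable_subtype_coe hA), Subtype.image_preimage_coe]
  rfl

/-- The sphere measure of a set is a multiple of the volume of the cone over it, and isometries
preserve volume and carry cones to cones. -/
theorem measurePreserving_sphereMeasure {k : ℕ} (R : Space k ≃ₗᵢ[ℝ] Space k) :
    MeasurePreserving R (sphereMeasure k) (sphereMeasure k) := by
  refine ⟨R.continuous.measurable, ?_⟩
  ext A hA
  rw [Measure.map_apply R.continuous.measurable hA, sphereMeasure_apply hA,
    sphereMeasure_apply (R.continuous.measurable hA)]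
  congr 1
  rw [← R.measurePreserving.measure_preimage_equiv (f := R.toHomeomorph.toMeasurableEquiv)
    (image2 (fun (r : ℝ) (x : Space k) => r • x) (Ioo 0 1) (Metric.sphere 0 1 ∩ A))]
  congr 1
  ext x
  constructor
  · rintro ⟨r, hr, y, ⟨hy, hyA⟩, rfl⟩
    exact ⟨r, hr, R y, ⟨by simpa using hy, hyA⟩, (R.map_smul r y).symm⟩
  · rintro ⟨r, hr, y, ⟨hy, hyA⟩, hxy⟩
    refine ⟨r, hr, R.symm y, ⟨by simpa using hy, by simpa using hyA⟩, ?_⟩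
    apply R.injective
    simpa using hxy

/-- The measure on pairs of a point and a unit direction. -/
noncomputable def flowMeasure (k : ℕ) : Measure (Space k × Space k) :=
  (volume : Measure (Space k)).prod (sphereMeasure k)

theorem measurable_mirror {k : ℕ} : Measurable fun x : Space k × Space k => mirror x.1 x.2 := by
  unfold mirror
  fun_prop

/-- The derivative of `p ↦ (lineAt (γ p) u (l p)).1`, where `A` is the derivative of `γ`. -/
noncomputable def lineDeriv {k : ℕ} (l : Space k →L[ℝ] ℝ) (A : Space k →L[ℝ] Space k)
    (u : Space k) : Space k →L[ℝ] Space k :=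
  A + (l - (innerSL ℝ u).comp A).smulRight u

theorem hasFDerivAt_lineAt {k : ℕ} {γ : Space k → Space k} {p : Space k}
    (hγ : DifferentiableAt ℝ γ p) (l : Space k →L[ℝ] ℝ) (u : Space k) :
    HasFDerivAt (fun p => (lineAt (γ p) u (l p)).1) (lineDeriv l (fderiv ℝ γ p) u) p := by
  have h1 := hγ.hasFDerivAt
  have h2 : HasFDerivAt (fun p => inner ℝ (γ p) u) ((innerSL ℝ u).comp (fderiv ℝ γ p)) p := by
    have := ((innerSL ℝ u).hasFDerivAt (x := γ p)).comp p h1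
    refine this.congr_of_eventuallyEq (Eventually.of_forall fun x => ?_)
    exact real_inner_comm _ _
  exact h1.add ((l.hasFDerivAt.sub h2).smul_const u)

/-- Reflecting the direction in a mirror that contains the range of `A` changes `lineDeriv` only
by an isometry. -/
theorem abs_det_lineDeriv_mirror {k : ℕ} (l : Space k →L[ℝ] ℝ) {A : Space k →L[ℝ] Space k}
    {n : Space k} (hn : ‖n‖ = 1) (hA : ∀ h, inner ℝ (A h) n = 0) (u : Space k) :
    |(lineDeriv l A (mirror n u)).det| = |(lineDeriv l A u).det| := by
  -- The mirror fixes the range of `A` and preserves inner products, so reflecting `u` amounts to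
  -- composing the whole derivative with the mirror.
  have hmA : ∀ h, mirror n (A h) = A h := fun h => by simp [mirror, hA h]
  have hcomp : (lineDeriv l A (mirror n u)).toLinearMap =
      (mirrorEquiv n hn).toLinearEquiv.toLinearMap ∘ₗ (lineDeriv l A u).toLinearMap := by
    ext1 h
    change A h + (l h - inner ℝ (mirror n u) (A h)) • mirror n u =
      mirrorEquiv n hn (A h + (l h - inner ℝ u (A h)) • u)
    rw [map_add, LinearIsometryEquiv.map_smul, mirrorEquiv_apply, mirrorEquiv_apply, hmA]
    conv_lhs => rw [← hmA h, inner_mirror_mirror hn, hmA]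
  rw [ContinuousLinearMap.det, hcomp, LinearMap.det_comp, abs_mul]
  have h1 : |LinearMap.det (mirrorEquiv n hn).toLinearEquiv.toLinearMap| = 1 := by
    have h2 : (mirrorEquiv n hn).toLinearEquiv.toLinearMap ∘ₗ
        (mirrorEquiv n hn).toLinearEquiv.toLinearMap = LinearMap.id := by
      ext1 h
      exact mirror_mirror hn h
    have h3 := congrArg LinearMap.det h2
    rw [LinearMap.det_comp, LinearMap.det_id, ← sq] at h3
    rw [← abs_one, ← sq_eq_sq_iff_abs_eq_abs, h3, one_pow]
  rw [h1, one_mul]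

theorem continuous_lineDeriv {k : ℕ} (l : Space k →L[ℝ] ℝ) :
    Continuous fun x : (Space k →L[ℝ] Space k) × Space k => lineDeriv l x.1 x.2 := by
  unfold lineDeriv
  have h : Continuous fun x : (Space k →L[ℝ] Space k) × Space k =>
      l - (innerSL ℝ x.2).comp x.1 := by
    fun_prop
  exact continuous_fst.add
    (((ContinuousLinearMap.smulRightL ℝ (Space k) (Space k)).continuous.comp h).clm_apply
      continuous_snd)

section Patch

variable {k : ℕ} {S U : Set (Space k)} {γ N : Space k → Space k}

/-- The line with direction `u` through the point `γ p`, with parameter `l p`. -/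
noncomputable def lineMap (γ : Space k → Space k) (l : Space k →L[ℝ] ℝ)
    (x : Space k × Space k) : Space k × Space k :=
  lineAt (γ x.1) x.2 (l x.1)

theorem measurable_lineMap (hγ : Measurable γ) (l : Space k →L[ℝ] ℝ) :
    Measurable (lineMap γ l) := by
  unfold lineMap lineAt
  fun_prop

theorem injOn_lineMap {l : Space k →L[ℝ] ℝ}
    (hinj : ∀ u ∈ U, InjOn (fun p => (lineAt (γ p) u (l p)).1) S) :
    InjOn (lineMap γ l) (S ×ˢ U) := by
  rintro ⟨p, u⟩ hp ⟨p', u'⟩ hp' h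
  obtain ⟨h1, h2⟩ := Prod.ext_iff.1 h
  change u = u' at h2
  subst h2
  exact Prod.ext (hinj u hp.2 hp.1 hp'.1 h1) rfl

theorem measurable_lineDeriv_fderiv (l : Space k →L[ℝ] ℝ) :
    Measurable fun x : Space k × Space k =>
      ENNReal.ofReal |(lineDeriv l (fderiv ℝ γ x.1) x.2).det| := by
  have h1 : Measurable fun x : Space k × Space k => (fderiv ℝ γ x.1, x.2) :=
    ((measurable_fderiv ℝ γ).comp measurable_fst).prodMk measurable_snd
  have h2 : Measurable fun x : (Space k →L[ℝ] Space k) × Space k => |(lineDeriv l x.1 x.2).det| :=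
    (ContinuousLinearMap.continuous_det.comp (continuous_lineDeriv l)).abs.measurable
  exact (h2.comp h1).ennreal_ofReal

/-- The direction is left unchanged by `lineMap`, so this is the change of variables formula in each
slice of constant direction, followed by Fubini. -/
theorem flowMeasure_image_lineMap (hγ : Measurable γ) (l : Space k →L[ℝ] ℝ)
    (hdiff : ∀ p ∈ S, DifferentiableAt ℝ γ p)
    (hinj : ∀ u ∈ U, InjOn (fun p => (lineAt (γ p) u (l p)).1) S)
    {B : Set (Space k × Space k)} (hB : MeasurableSet B) (hBS : B ⊆ S ×ˢ U) :
    flowMeasure k (lineMap γ l '' B) =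
      ∫⁻ x in B, ENNReal.ofReal |(lineDeriv l (fderiv ℝ γ x.1) x.2).det| ∂(flowMeasure k) := by
  have him : MeasurableSet (lineMap γ l '' B) :=
    hB.image_of_measurable_injOn (measurable_lineMap hγ l) ((injOn_lineMap hinj).mono hBS)
  rw [← lintegral_indicator hB, flowMeasure, Measure.prod_apply_symm him,
    lintegral_prod_symm _ ((measurable_lineDeriv_fderiv l).indicator hB).aemeasurable]
  refine lintegral_congr fun u => ?_
  have hBu : MeasurableSet ((fun p => (p, u)) ⁻¹' B) := measurable_prodMk_right hB
  have hslice : (fun z => (z, u)) ⁻¹' (lineMap γ l '' B) =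
      (fun p => (lineAt (γ p) u (l p)).1) '' ((fun p => (p, u)) ⁻¹' B) := by
    ext z
    constructor
    · rintro ⟨⟨p, u'⟩, hp, h⟩
      obtain ⟨h1, h2⟩ := Prod.ext_iff.1 h
      change u' = u at h2
      subst h2
      exact ⟨p, hp, h1⟩
    · rintro ⟨p, hp, rfl⟩
      exact ⟨(p, u), hp, rfl⟩
  have hInj : InjOn (fun p => (lineAt (γ p) u (l p)).1) ((fun p => (p, u)) ⁻¹' B) := by
    intro p hp p' hp' h
    exact hinj u (hBS hp).2 (hBS hp).1 (hBS hp').1 h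
  rw [hslice, ← lintegral_abs_det_fderiv_eq_addHaar_image volume hBu
    (fun p hp => (hasFDerivAt_lineAt (hdiff p (hBS hp).1) l u).hasFDerivWithinAt) hInj,
    ← lintegral_indicator hBu]
  rfl

/-- The reflection of lines in a parametrised patch of a hypersurface does not increase
measure. -/
theorem exists_isSubpreservingOn_patch (hS : MeasurableSet S) (hU : MeasurableSet U)
    (hγ : Measurable γ) (hN : Measurable N) (l : Space k →L[ℝ] ℝ)
    (hN1 : ∀ p ∈ S, ‖N p‖ = 1) (hdiff : ∀ p ∈ S, DifferentiableAt ℝ γ p)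
    (horth : ∀ p ∈ S, ∀ h, inner ℝ (fderiv ℝ γ p h) (N p) = 0)
    (hinj : ∀ u ∈ U, InjOn (fun p => (lineAt (γ p) u (l p)).1) S) :
    ∃ f D, IsSubpreservingOn (flowMeasure k) f D ∧
      ∀ p ∈ S, ∀ u ∈ U, mirror (N p) u ∈ U → lineAt (γ p) u (l p) ∈ D ∧
        f (lineAt (γ p) u (l p)) = lineAt (γ p) (mirror (N p) u) (l p) := by
  -- In the coordinates `(p, u)` reflection acts on the direction alone and is an involution over
  -- `S`. Restricting to `O` keeps both the incoming and the outgoing direction in `U`.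
  let ρ : Space k × Space k → Space k × Space k := fun x => (x.1, mirror (N x.1) x.2)
  have hρ : Measurable ρ :=
    measurable_fst.prodMk (measurable_mirror.comp ((hN.comp measurable_fst).prodMk measurable_snd))
  have hρρ : ∀ x ∈ S ×ˢ (univ : Set (Space k)), ρ (ρ x) = x := fun x hx =>
    Prod.ext rfl (mirror_mirror (hN1 x.1 hx.1) x.2)
  let O : Set (Space k × Space k) := (S ×ˢ U) ∩ ρ ⁻¹' (S ×ˢ U)
  have hO : MeasurableSet O := (hS.prod hU).inter (hρ (hS.prod hU))
  have hG := measurable_lineMap hγ l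
  have hGO : InjOn (lineMap γ l) O := (injOn_lineMap hinj).mono inter_subset_left
  classical
  let f : Space k × Space k → Space k × Space k := fun a =>
    lineMap γ l (ρ (Function.invFunOn (lineMap γ l) O a))
  have hf : ∀ x ∈ O, f (lineMap γ l x) = lineMap γ l (ρ x) := fun x hx => by
    change lineMap γ l (ρ (Function.invFunOn (lineMap γ l) O (lineMap γ l x))) = _
    rw [hGO.leftInvOn_invFunOn hx]
  refine ⟨f, lineMap γ l '' O, ?_, ?_⟩
  · intro A hA
    let B : Set (Space k × Space k) := O ∩ (fun x => lineMap γ l (ρ x)) ⁻¹' A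
    let B' : Set (Space k × Space k) := O ∩ lineMap γ l ⁻¹' A
    have hB : MeasurableSet B := hO.inter ((hG.comp hρ) hA)
    have hB' : MeasurableSet B' := hO.inter (hG hA)
    have hfB : lineMap γ l '' O ∩ f ⁻¹' A = lineMap γ l '' B := by
      ext a
      constructor
      · rintro ⟨⟨x, hx, rfl⟩, hxA⟩
        rw [mem_preimage, hf x hx] at hxA
        exact ⟨x, ⟨hx, hxA⟩, rfl⟩
      · rintro ⟨x, ⟨hx, hxA⟩, rfl⟩
        refine ⟨⟨x, hx, rfl⟩, ?_⟩
        rw [mem_preimage, hf x hx]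
        exact hxA
    have hBO : B ⊆ S ×ˢ U := fun x hx => hx.1.1
    have hBO' : B' ⊆ S ×ˢ U := fun x hx => hx.1.1
    rw [hfB]
    refine ⟨hB.image_of_measurable_injOn hG (hGO.mono inter_subset_left), ?_⟩
    -- Here `B' = ρ(B)`. At fixed `p` the substitution of the mirrored direction preserves both the
    -- sphere measure and the Jacobian.
    have hkey : flowMeasure k (lineMap γ l '' B) = flowMeasure k (lineMap γ l '' B') := by
      rw [flowMeasure_image_lineMap hγ l hdiff hinj hB hBO,
        flowMeasure_image_lineMap hγ l hdiff hinj hB' hBO', ← lintegral_indicator hB,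
        ← lintegral_indicator hB', flowMeasure,
        lintegral_prod _ ((measurable_lineDeriv_fderiv l).indicator hB).aemeasurable,
        lintegral_prod _ ((measurable_lineDeriv_fderiv l).indicator hB').aemeasurable]
      refine lintegral_congr fun p => ?_
      by_cases hp : p ∈ S
      · have hR := measurePreserving_sphereMeasure (mirrorEquiv (N p) (hN1 p hp))
        refine (lintegral_congr fun u => ?_).trans (hR.lintegral_comp
          (((measurable_lineDeriv_fderiv l).indicator hB').comp measurable_prodMk_left))
        change B.indicator _ (p, u) = B'.indicator _ (ρ (p, u))
        have hmem : ρ (p, u) ∈ B' ↔ (p, u) ∈ B := by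
          have h1 := hρρ (p, u) ⟨hp, mem_univ _⟩
          simp only [B, B', O, mem_inter_iff, mem_preimage, h1]
          tauto
        by_cases hpu : (p, u) ∈ B
        · rw [indicator_of_mem hpu, indicator_of_mem (hmem.2 hpu)]
          change _ = ENNReal.ofReal |(lineDeriv l (fderiv ℝ γ p) (mirror (N p) u)).det|
          rw [abs_det_lineDeriv_mirror l (hN1 p hp) (horth p hp)]
        · rw [indicator_of_notMem hpu, indicator_of_notMem (fun h => hpu (hmem.1 h))]
      · refine lintegral_congr fun u => ?_
        rw [indicator_of_notMem fun h => hp (hBO h).1, indicator_of_notMem fun h => hp (hBO' h).1]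
    rw [hkey]
    refine measure_mono ?_
    rintro _ ⟨x, hx, rfl⟩
    exact hx.2
  · intro p hp u hu hu'
    have hx : (p, u) ∈ O := ⟨⟨hp, hu⟩, hp, hu'⟩
    exact ⟨⟨(p, u), hx, rfl⟩, hf _ hx⟩

end Patch

/-! ### Reflection of lines near a regular point -/

/-- The gradient of `φ` at `z`, normalised. -/
noncomputable def unitGradient {k : ℕ} (φ : Space k → ℝ) (z : Space k) : Space k :=
  ‖gradient φ z‖⁻¹ • gradient φ z

theorem measurable_unitGradient {k : ℕ} (φ : Space k → ℝ) : Measurable (unitGradient φ) := by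
  have h : Measurable (gradient φ) :=
    (InnerProductSpace.toDual ℝ (Space k)).symm.continuous.measurable.comp (measurable_fderiv ℝ φ)
  exact h.norm.inv.smul h

theorem norm_unitGradient {k : ℕ} {φ : Space k → ℝ} {z : Space k} (h : fderiv ℝ φ z ≠ 0) :
    ‖unitGradient φ z‖ = 1 := by
  have h1 : gradient φ z ≠ 0 := by simpa [gradient] using h
  rw [unitGradient, norm_smul, norm_inv, norm_norm, inv_mul_cancel₀ (norm_ne_zero_iff.2 h1)]

theorem continuousAt_unitGradient {k : ℕ} {φ : Space k → ℝ} {z : Space k}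
    (hφ : ContDiffAt ℝ 1 φ z) (h : fderiv ℝ φ z ≠ 0) : ContinuousAt (unitGradient φ) z := by
  have h1 : ‖gradient φ z‖ ≠ 0 := by simpa [gradient] using h
  have h2 : ContinuousAt (gradient φ) z :=
    (InnerProductSpace.toDual ℝ (Space k)).symm.continuous.continuousAt.comp
      (hφ.continuousAt_fderiv one_ne_zero)
  exact (h2.norm.inv₀ h1).smul h2

theorem continuousAt_mirror_unitGradient {k : ℕ} {φ : Space k → ℝ} {z : Space k}
    (hφ : ContDiffAt ℝ 1 φ z) (h : fderiv ℝ φ z ≠ 0) (u : Space k) :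
    ContinuousAt (fun x : Space k × Space k => mirror (unitGradient φ x.1) x.2) (z, u) := by
  have h1 : Continuous fun x : Space k × Space k => mirror x.1 x.2 := by
    unfold mirror
    fun_prop
  exact h1.continuousAt.comp (ContinuousAt.prodMk
    (ContinuousAt.comp (continuousAt_unitGradient hφ h) continuousAt_fst) continuousAt_snd)

theorem inner_unitGradient {k : ℕ} (φ : Space k → ℝ) (z h : Space k) :
    inner ℝ h (unitGradient φ z) = ‖gradient φ z‖⁻¹ * fderiv ℝ φ z h := by
  rw [unitGradient, real_inner_smul_right, real_inner_comm, gradient,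
    InnerProductSpace.toDual_symm_apply]

theorem isUnitNormal_unitGradient {k : ℕ} {M U : Set (Space k)} {φ : Space k → ℝ} (hU : IsOpen U)
    (hφ : ContDiffOn ℝ (⊤ : ℕ∞) φ U) (hM : M ∩ U = {z ∈ U | φ z = 0}) {q : Space k}
    (hq : q ∈ M) (hqU : q ∈ U) (h : fderiv ℝ φ q ≠ 0) :
    IsUnitNormal M q (unitGradient φ q) := by
  have h1 : ‖gradient φ q‖ ≠ 0 := by simpa [gradient] using h
  refine ⟨hq, norm_unitGradient h, U, hU, hqU, fun z => ‖gradient φ q‖⁻¹ * φ z,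
    contDiffOn_const.mul hφ, ?_, ?_⟩
  · rw [hM]
    ext z
    simp [h1]
  · have hd : DifferentiableAt ℝ φ q :=
      (hφ.contDiffAt (hU.mem_nhds hqU)).differentiableAt (by simp)
    have h2 := hd.hasGradientAt.hasFDerivAt.const_mul ‖gradient φ q‖⁻¹
    rw [hasGradientAt_iff_hasFDerivAt, unitGradient, map_smulₛₗ]
    simpa using h2

/-- Two zeros of `φ` in a convex set on a line transversal to the level sets coincide. -/
theorem eq_zero_of_zeros_on_transversal {k : ℕ} {W : Set (Space k)} (hW : Convex ℝ W)
    {φ : Space k → ℝ} (hφ : ∀ z ∈ W, DifferentiableAt ℝ φ z) {u : Space k}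
    (hu : ∀ z ∈ W, fderiv ℝ φ z u ≠ 0) {z : Space k} {c : ℝ} (hz : z ∈ W) (hz' : z + c • u ∈ W)
    (h : φ z = 0) (h' : φ (z + c • u) = 0) : c = 0 := by
  obtain ⟨ξ, hξ, heq⟩ := domain_mvt (f' := fun x => fderiv ℝ φ x)
    (fun x hx => (hφ x hx).hasFDerivAt.hasFDerivWithinAt) hW hz hz'
  rw [h, h', sub_zero, add_sub_cancel_left, map_smul, smul_eq_mul, eq_comm] at heq
  exact (mul_eq_zero.1 heq).resolve_right (hu ξ (hW.segment_subset hz hz' hξ))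

-- Straightening the surface turns a point `p` of the whole space into patch coordinates: its
-- projection orthogonal to `n₀` labels a point of the surface, and its component along `n₀` is the
-- line parameter. Source and target then have equal dimension. Directions uniformly transversal to
-- the patch meet it at most once, which gives injectivity.
set_option maxHeartbeats 1000000 in
theorem exists_isSubpreservingOn_nhds {k : ℕ} {M : Set (Space k)} {q₀ n₀ u₀ : Space k}
    (hn₀ : IsUnitNormal M q₀ n₀) (hu₀ : ‖u₀‖ = 1) (htrans : inner ℝ u₀ n₀ ≠ 0) :
    ∃ O ∈ 𝓝 (q₀, u₀), ∃ f D, IsSubpreservingOn (flowMeasure k) f D ∧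
      ∀ q u, (q, u) ∈ O → ∀ n t, IsUnitNormal M q n → ‖u‖ = 1 →
        lineAt q u t ∈ D ∧ f (lineAt q u t) = lineAt q (mirror n u) t := by
  obtain ⟨hq₀, hn₀1, U, hU, hq₀U, φ, hφ, hM, hg⟩ := hn₀
  have hφ₀ : ContDiffAt ℝ 1 φ q₀ := (hφ.contDiffAt (hU.mem_nhds hq₀U)).of_le (by simp)
  have hgrad₀ : gradient φ q₀ = n₀ := hg.gradient
  have hφq₀ : φ q₀ = 0 := (hM.subset ⟨hq₀, hq₀U⟩).2
  have hn₀n₀ : inner ℝ n₀ n₀ = (1 : ℝ) := by rw [real_inner_self_eq_norm_sq, hn₀1, one_pow]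
  -- With this margin, a variation of the differential of `φ` by less than `η` cannot cancel its
  -- value on a unit direction whose component along `n₀` exceeds `η`.
  set η : ℝ := |inner ℝ n₀ u₀| / 2 with hη
  have htrans' : 0 < |inner ℝ n₀ u₀| := abs_pos.2 (by rwa [real_inner_comm])
  -- directions transversal to the patch
  let V : Set (Space k) := {u | ‖u‖ = 1 ∧ η < |inner ℝ n₀ u|}
  have hu₀V : u₀ ∈ V := ⟨hu₀, by rw [hη]; linarith⟩
  have hfd : ContinuousAt (fderiv ℝ φ) q₀ := hφ₀.continuousAt_fderiv one_ne_zero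
  obtain ⟨r, hr, hball⟩ : ∃ r > 0, ∀ z ∈ Metric.ball q₀ r,
      z ∈ U ∧ ‖fderiv ℝ φ z - fderiv ℝ φ q₀‖ < η := by
    have h1 : ∀ᶠ z in 𝓝 q₀, z ∈ U ∧ ‖fderiv ℝ φ z - fderiv ℝ φ q₀‖ < η := by
      refine Filter.Eventually.and (hU.mem_nhds hq₀U) ?_
      have := Metric.continuousAt_iff'.1 hfd η (by rw [hη]; linarith)
      simpa only [dist_eq_norm] using this
    exact Metric.eventually_nhds_iff_ball.1 h1
  set W := Metric.ball q₀ r with hW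
  have hWd : ∀ z ∈ W, DifferentiableAt ℝ φ z := fun z hz =>
    (hφ.contDiffAt (hU.mem_nhds (hball z hz).1)).differentiableAt (by simp)
  have hWV : ∀ z ∈ W, ∀ u ∈ V, fderiv ℝ φ z u ≠ 0 := by
    intro z hz u hu h0
    have h1 : fderiv ℝ φ q₀ u = inner ℝ n₀ u := by
      rw [hg.hasFDerivAt.fderiv, InnerProductSpace.toDual_apply_apply]
    have h2 := (fderiv ℝ φ z - fderiv ℝ φ q₀).le_opNorm u
    rw [_root_.sub_apply, h0, h1, zero_sub, norm_neg, hu.1, mul_one,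
      Real.norm_eq_abs] at h2
    linarith [hu.2, (hball z hz).2]
  have hWne : ∀ z ∈ W, fderiv ℝ φ z ≠ 0 := fun z hz h0 => hWV z hz u₀ hu₀V (by rw [h0]; rfl)
  -- straightening of the hypersurface
  let Ψ : Space k → Space k := fun z => z + (φ z - inner ℝ n₀ z) • n₀
  have hΨinner : ∀ z, inner ℝ n₀ (Ψ z) = φ z := fun z => by
    simp only [Ψ, inner_add_right, real_inner_smul_right, hn₀n₀]; ring
  have hΨc : ContDiffAt ℝ 1 Ψ q₀ :=
    contDiffAt_id.add ((hφ₀.sub (contDiffAt_const.inner ℝ contDiffAt_id)).smul contDiffAt_const)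
  have hΨ' : HasFDerivAt Ψ
      ((ContinuousLinearEquiv.refl ℝ (Space k) : Space k ≃L[ℝ] Space k) :
        Space k →L[ℝ] Space k) q₀ := by
    have h1 := (hasFDerivAt_id (𝕜 := ℝ) q₀).add
      ((hg.hasFDerivAt.sub (innerSL ℝ n₀).hasFDerivAt).smul_const n₀)
    refine (h1.congr_fderiv ?_).congr_of_eventuallyEq (Eventually.of_forall fun x => rfl)
    ext1 h
    simp
  let e := hΨc.toOpenPartialHomeomorph Ψ hΨ' one_ne_zero
  have hecoe : ∀ z, e z = Ψ z := fun z =>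
    congrFun (hΨc.toOpenPartialHomeomorph_coe hΨ' one_ne_zero) z
  have hq₀e : q₀ ∈ e.source := hΨc.mem_toOpenPartialHomeomorph_source hΨ' one_ne_zero
  have hq₀t : Ψ q₀ ∈ e.target := hΨc.image_mem_toOpenPartialHomeomorph_target hΨ' one_ne_zero
  have heq₀ : e.symm (Ψ q₀) = q₀ := by rw [← hecoe]; exact e.left_inv hq₀e
  have hΘ : ContDiffAt ℝ 1 e.symm (Ψ q₀) := hΨc.to_localInverse hΨ' one_ne_zero
  obtain ⟨S₀, hS₀sub, hS₀, hq₀S₀⟩ : ∃ S₀ ⊆ {s | s ∈ e.target ∧ e.symm s ∈ W ∧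
      DifferentiableAt ℝ e.symm s}, IsOpen S₀ ∧ Ψ q₀ ∈ S₀ := by
    refine mem_nhds_iff.1 ?_
    refine Filter.inter_mem (e.open_target.mem_nhds hq₀t) (Filter.inter_mem ?_ ?_)
    · exact hΘ.continuousAt.preimage_mem_nhds (by rw [heq₀]; exact Metric.ball_mem_nhds _ hr)
    · filter_upwards [hΘ.eventually (by simp)] with s hs using hs.differentiableAt one_ne_zero
  let l : Space k →L[ℝ] ℝ := innerSL ℝ n₀
  let π : Space k → Space k := fun p => p - l p • n₀
  have hπd : Differentiable ℝ π := by fun_prop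
  have hπl : ∀ p, inner ℝ n₀ (π p) = 0 := fun p => by
    simp only [π, l, innerSL_apply_apply, inner_sub_right, real_inner_smul_right, hn₀n₀]; ring
  let S : Set (Space k) := π ⁻¹' S₀
  have hS : IsOpen S := hS₀.preimage hπd.continuous
  -- Extension by zero makes the parametrisation globally measurable without changing it on the open
  -- set `S`.
  let γ : Space k → Space k := S.indicator (fun p => e.symm (π p))
  have hγS : ∀ p ∈ S, γ p = e.symm (π p) := fun p hp => indicator_of_mem hp _
  have hγev : ∀ p ∈ S, γ =ᶠ[𝓝 p] fun p => e.symm (π p) := fun p hp =>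
    mem_of_superset (hS.mem_nhds hp) hγS
  have hγW : ∀ p ∈ S, γ p ∈ W := fun p hp => by rw [hγS p hp]; exact (hS₀sub hp).2.1
  have hΨγ : ∀ p ∈ S, Ψ (γ p) = π p := fun p hp => by
    rw [hγS p hp, ← hecoe]; exact e.right_inv (hS₀sub hp).1
  have hφγ : ∀ p ∈ S, φ (γ p) = 0 := fun p hp => by rw [← hΨinner, hΨγ p hp, hπl]
  have hγd : ∀ p ∈ S, DifferentiableAt ℝ γ p := fun p hp =>
    (((hS₀sub hp).2.2).comp p (hπd p)).congr_of_eventuallyEq (hγev p hp)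
  have hγm : Measurable γ := by
    have h1 : ContinuousOn (fun p => e.symm (π p)) S := fun p hp =>
      (((hS₀sub hp).2.2).comp p (hπd p)).continuousAt.continuousWithinAt
    classical
    have h2 := h1.measurable_piecewise (g := 0) continuousOn_const hS.measurableSet
    rwa [piecewise_eq_indicator] at h2
  let N : Space k → Space k := fun p => unitGradient φ (γ p)
  have horth : ∀ p ∈ S, ∀ h, inner ℝ (fderiv ℝ γ p h) (N p) = 0 := by
    intro p hp h
    rw [inner_unitGradient]
    have h1 : HasFDerivAt (fun p => φ (γ p)) ((fderiv ℝ φ (γ p)).comp (fderiv ℝ γ p)) p :=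
      (hWd _ (hγW p hp)).hasFDerivAt.comp p (hγd p hp).hasFDerivAt
    have h2 : (fun p => φ (γ p)) =ᶠ[𝓝 p] fun _ => 0 := mem_of_superset (hS.mem_nhds hp) hφγ
    have h3 := h1.unique ((hasFDerivAt_const (0 : ℝ) p).congr_of_eventuallyEq h2)
    have h4 := congrArg (fun A : Space k →L[ℝ] ℝ => A h) h3
    simp only [ContinuousLinearMap.comp_apply, _root_.zero_apply] at h4
    rw [h4, mul_zero]
  have hinj : ∀ u ∈ V, InjOn (fun p => (lineAt (γ p) u (l p)).1) S := by
    intro u hu p hp p' hp' h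
    change γ p + (l p - inner ℝ (γ p) u) • u = γ p' + (l p' - inner ℝ (γ p') u) • u at h
    -- The two surface points lie on one line of direction `u`, so transversality makes them equal;
    -- then the parameters agree too.
    have h1 : γ p' = γ p + ((l p - inner ℝ (γ p) u) - (l p' - inner ℝ (γ p') u)) • u := by
      rw [sub_smul, ← add_sub_assoc, h, add_sub_cancel_right]
    have hc := eq_zero_of_zeros_on_transversal (convex_ball q₀ r) hWd
      (fun z hz => hWV z hz u hu) (hγW p hp) (h1 ▸ hγW p' hp') (hφγ p hp) (h1 ▸ hφγ p' hp')
    rw [hc, zero_smul, add_zero] at h1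
    rw [h1] at hc
    have hl : l p = l p' := by linarith
    have hππ : π p = π p' := by rw [← hΨγ p hp, ← hΨγ p' hp', h1]
    simp only [π, hl] at hππ
    exact sub_left_injective hππ
  have hVm : MeasurableSet V :=
    (measurableSet_eq_fun measurable_norm measurable_const).inter
      (measurableSet_lt (f := fun _ => η) (g := fun u : Space k => |inner ℝ n₀ u|)
        measurable_const (by fun_prop))
  obtain ⟨f, D, hfD, hpatch⟩ := exists_isSubpreservingOn_patch hS.measurableSet hVm hγm
    ((measurable_unitGradient φ).comp hγm) l (fun p hp => norm_unitGradient (hWne _ (hγW p hp)))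
    hγd horth hinj
  refine ⟨{x | x.1 ∈ W ∧ x.1 ∈ e.source ∧ Ψ x.1 ∈ S₀ ∧ η < |inner ℝ n₀ x.2| ∧
    η < |inner ℝ n₀ (mirror (unitGradient φ x.1) x.2)|}, ?_, f, D, hfD, ?_⟩
  · have hc1 : ContinuousAt (fun x : Space k × Space k => x.1) (q₀, u₀) := continuousAt_fst
    have hug : unitGradient φ q₀ = n₀ := by rw [unitGradient, hgrad₀, hn₀1, inv_one, one_smul]
    have hmc := continuousAt_mirror_unitGradient hφ₀ (hWne q₀ (Metric.mem_ball_self hr)) u₀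
    refine Filter.inter_mem (hc1 (Metric.ball_mem_nhds _ hr))
      (Filter.inter_mem (hc1 (e.open_source.mem_nhds hq₀e)) (Filter.inter_mem ?_
        (Filter.inter_mem ?_ ?_)))
    · exact ContinuousAt.preimage_mem_nhds (f := fun x : Space k × Space k => Ψ x.1)
        (ContinuousAt.comp (g := Ψ) hΨc.continuousAt hc1) (hS₀.mem_nhds hq₀S₀)
    · refine ContinuousAt.eventually_lt (f := fun _ => η) continuousAt_const
        (g := fun x : Space k × Space k => |inner ℝ n₀ x.2|) (by fun_prop) hu₀V.2
    · refine ContinuousAt.eventually_lt (f := fun _ => η) continuousAt_const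
        (g := fun x : Space k × Space k => |inner ℝ n₀ (mirror (unitGradient φ x.1) x.2)|)
        ((continuousAt_const.inner hmc).abs) ?_
      change η < |inner ℝ n₀ (mirror (unitGradient φ q₀) u₀)|
      rw [hug, real_inner_comm, inner_mirror_normal hn₀1, abs_neg, real_inner_comm]
      exact hu₀V.2
  · rintro q u ⟨hqW, hqe, hqS₀, hu1, hu2⟩ n t hn hu
    dsimp only at hqW hqe hqS₀ hu1 hu2
    have hφq : φ q = 0 := (hM.subset ⟨hn.1, (hball q hqW).1⟩).2
    -- The patch coordinate of the point `q` with parameter `t` is `Ψ q + t • n₀`.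
    have hlp : l (Ψ q + t • n₀) = t := by
      change inner ℝ n₀ (Ψ q + t • n₀) = t
      rw [inner_add_right, hΨinner, real_inner_smul_right, hn₀n₀, hφq]; ring
    have hπp : π (Ψ q + t • n₀) = Ψ q := by
      simp only [π, hlp, add_sub_cancel_right]
    have hpS : Ψ q + t • n₀ ∈ S := by
      change π _ ∈ S₀
      rwa [hπp]
    have hγp : γ (Ψ q + t • n₀) = q := by
      rw [hγS _ hpS, hπp, ← hecoe]; exact e.left_inv hqe
    have hnq := isUnitNormal_unitGradient hU hφ hM hn.1 (hball q hqW).1 (hWne q hqW)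
    have h1 := hpatch _ hpS u ⟨hu, hu1⟩ (by
      change mirror (unitGradient φ (γ _)) u ∈ V
      rw [hγp]
      exact ⟨(norm_mirror hnq.2.1 u).trans hu, hu2⟩)
    change _ ∧ f _ = lineAt _ (mirror (unitGradient φ (γ _)) u) _ at h1
    rw [hγp, hlp] at h1
    rw [hnq.mirror_eq hn u]
    exact h1

/-- The Lindelöf property of the set of transversal point-direction pairs extracts countably many of
the local maps. -/
theorem countablySubpreserving_reflects {k : ℕ} (M : Set (Space k)) :
    CountablySubpreserving (flowMeasure k) (Reflects M) := by
  let Y : Set (Space k × Space k) :=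
    {x | ∃ n, IsUnitNormal M x.1 n ∧ ‖x.2‖ = 1 ∧ inner ℝ x.2 n ≠ 0}
  have hex : ∀ x : Space k × Space k, x ∈ Y → ∃ O ∈ 𝓝 x,
      ∃ g : (Space k × Space k → Space k × Space k) × Set (Space k × Space k),
        IsSubpreservingOn (flowMeasure k) g.1 g.2 ∧
        ∀ q u, (q, u) ∈ O → ∀ n t, IsUnitNormal M q n → ‖u‖ = 1 →
          lineAt q u t ∈ g.2 ∧ g.1 (lineAt q u t) = lineAt q (mirror n u) t := by
    rintro ⟨q₀, u₀⟩ ⟨n₀, hn₀, hu₀, htrans⟩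
    obtain ⟨O, hO, f, D, h1, h2⟩ := exists_isSubpreservingOn_nhds hn₀ hu₀ htrans
    exact ⟨O, hO, (f, D), h1, h2⟩
  choose! O hO g hg hcov using hex
  obtain ⟨T, hTY, hT, hYT⟩ := TopologicalSpace.countable_cover_nhdsWithin (f := O) (s := Y)
    fun x hx => mem_nhdsWithin_of_mem_nhds (hO x hx)
  refine ⟨g '' T, hT.image g, ?_, ?_⟩
  · rintro _ ⟨x, hx, rfl⟩
    exact hg x (hTY hx)
  · rintro a b ⟨q, n, u, t, hn, htrans, hu, rfl, rfl⟩
    obtain ⟨x, hx, hxO⟩ := mem_iUnion₂.1 (hYT ⟨n, hn, hu, htrans⟩ : (q, u) ∈ _)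
    exact ⟨g x, mem_image_of_mem g hx, hcov x (hTY hx) q u hxO n t hn hu⟩

/-! ### The lines that start from the hyperplane -/

theorem height_incl {k : ℕ} (x : Plane k) : height (Plane.incl x) = 0 := by
  simp [height, Plane.incl]

theorem incl_injective {k : ℕ} : Function.Injective (Plane.incl (k := k)) := by
  intro x y h
  ext i
  simpa [Plane.incl] using congrArg (fun z : Space k => z i.castSucc) h

theorem norm_vec {k : ℕ} (v : HalfSphere k) : ‖HalfSphere.vec v‖ = 1 := by
  simp [HalfSphere.vec]

theorem vec_injective {k : ℕ} : Function.Injective (HalfSphere.vec (k := k)) := fun _ _ h =>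
  Subtype.ext (Subtype.ext h)

theorem measurable_vec {k : ℕ} : Measurable (HalfSphere.vec (k := k)) :=
  measurable_subtype_coe.comp measurable_subtype_coe

theorem measurable_incl {k : ℕ} : Measurable (Plane.incl (k := k)) := by
  refine (WithLp.measurable_toLp 2 _).comp (measurable_pi_iff.2 fun i => ?_)
  refine Fin.lastCases ?_ (fun i => ?_) i
  · simp
  · simp only [Fin.snoc_castSucc]
    exact (measurable_pi_apply i).comp (WithLp.measurable_ofLp 2 _)

instance (k : ℕ) : StandardBorelSpace (HalfSphere k) :=
  (measurableSet_halfSphere k).standardBorel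

/-- The vertical unit vector. -/
noncomputable def vertical (k : ℕ) : Space k := EuclideanSpace.single (Fin.last k) 1

theorem height_vertical (k : ℕ) : height (vertical k) = 1 := by
  simp [height, vertical]

/-- `height` as a linear functional. -/
def heightₗ (k : ℕ) : Space k →ₗ[ℝ] ℝ where
  toFun := height
  map_add' := height_add
  map_smul' := height_smul

theorem measurePreserving_incl_add_vertical (k : ℕ) :
    MeasurePreserving (fun y : Plane k × ℝ => Plane.incl y.1 + y.2 • vertical k)
      (volume.prod volume) volume := by
  have h1 := (PiLp.volume_preserving_toLp (Fin (k + 1))).comp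
    (((volume_preserving_piFinSuccAbove (fun _ : Fin (k + 1) => ℝ) (Fin.last k)).symm).comp
      (((MeasurePreserving.id (volume : Measure ℝ)).prod
        (PiLp.volume_preserving_ofLp (Fin k))).comp
        (Measure.measurePreserving_swap (μ := (volume : Measure (Plane k)))
          (ν := (volume : Measure ℝ)))))
  have h2 : ∀ y : Plane k × ℝ, Plane.incl y.1 + y.2 • vertical k = WithLp.toLp 2
      ((MeasurableEquiv.piFinSuccAbove (fun _ => ℝ) (Fin.last k)).symm (y.2, y.1.ofLp)) := by
    intro y
    ext i
    refine Fin.lastCases ?_ (fun i => ?_) i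
    · simp [Plane.incl, vertical, MeasurableEquiv.piFinSuccAbove, Fin.insertNthEquiv]
    · simp [Plane.incl, vertical, MeasurableEquiv.piFinSuccAbove, Fin.insertNthEquiv]
  simp_rw [h2]
  exact h1

/-- The flux through the hyperplane: the lines with direction `v` through a set of points of
`L_*` fill a volume proportional to the height of `v`. -/
theorem volume_image_lineAt_incl {k : ℕ} {v : Space k} (hv : 0 < height v)
    {C : Set (Plane k × ℝ)} (hC : MeasurableSet C) :
    volume ((fun y : Plane k × ℝ => (lineAt (Plane.incl y.1) v y.2).1) '' C) =
      ENNReal.ofReal (height v) * (volume.prod volume) C := by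
  let J : Plane k × ℝ → Space k := fun y => Plane.incl y.1 + y.2 • vertical k
  have hJ : MeasurePreserving J (volume.prod volume) volume := measurePreserving_incl_add_vertical k
  have hJh : ∀ y, height (J y) = y.2 := fun y => by
    rw [height_add, height_smul, height_incl, height_vertical]; ring
  have hJi : Function.Injective J := by
    intro y y' h
    have h2 : y.2 = y'.2 := by rw [← hJh, ← hJh, h]
    refine Prod.ext (incl_injective ?_) h2
    have h3 : Plane.incl y.1 + y.2 • vertical k = Plane.incl y'.1 + y'.2 • vertical k := h
    rw [h2] at h3
    exact add_right_cancel h3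
  let g : Space k →ₗ[ℝ] ℝ := (innerSL ℝ v).toLinearMap ∘ₗ
    (LinearMap.id - (heightₗ k).smulRight (vertical k))
  -- The inner shear subtracts `inner ℝ (Plane.incl x) v` from the vertical coordinate and has
  -- determinant 1. The outer map sends the vertical vector to `v` and fixes the hyperplane, with
  -- determinant `1 + (height v - 1)`.
  let A : Space k →ₗ[ℝ] Space k := LinearMap.transvection (heightₗ k) (v - vertical k) ∘ₗ
    LinearMap.transvection (-g) (vertical k)
  have hA : LinearMap.det A = height v := by
    rw [LinearMap.det_comp, LinearMap.transvection.det, LinearMap.transvection.det]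
    have h1 : g (vertical k) = 0 := by
      change inner ℝ v (vertical k - height (vertical k) • vertical k) = (0 : ℝ)
      rw [height_vertical, one_smul, sub_self, inner_zero_right]
    have h2 : heightₗ k (v - vertical k) = height v - 1 := by
      rw [map_sub]
      change height v - height (vertical k) = _
      rw [height_vertical]
    rw [LinearMap.neg_apply, h1, h2]
    ring
  have hAJ : ∀ y, A (J y) = (lineAt (Plane.incl y.1) v y.2).1 := by
    intro y
    have h1 : g (J y) = inner ℝ (Plane.incl y.1) v := by
      change inner ℝ v (J y - height (J y) • vertical k) = _
      rw [hJh, real_inner_comm]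
      simp [J]
    have h2 : heightₗ k (J y - g (J y) • vertical k) = y.2 - g (J y) := by
      change height (J y + -(g (J y) • vertical k)) = _
      rw [height_add, height_neg, height_smul, height_vertical, hJh]
      ring
    have h3 : LinearMap.transvection (-g) (vertical k) (J y) = J y - g (J y) • vertical k := by
      simp [LinearMap.transvection, sub_eq_add_neg]
    rw [LinearMap.comp_apply, h3]
    change (J y - g (J y) • vertical k) +
      heightₗ k (J y - g (J y) • vertical k) • (v - vertical k) = _
    rw [h2, h1]
    simp only [lineAt, J]
    module
  have himg : (fun y : Plane k × ℝ => (lineAt (Plane.incl y.1) v y.2).1) '' C = A '' (J '' C) := by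
    rw [image_image]
    exact image_congr fun y _ => (hAJ y).symm
  have hJC : MeasurableSet (J '' C) := hC.image_of_measurable_injOn hJ.measurable hJi.injOn
  rw [himg, Measure.addHaar_image_linearMap, hA, abs_of_pos hv, ← hJ.measure_preimage
    hJC.nullMeasurableSet, preimage_image_eq _ hJi]

/-- The line that leaves the hyperplane `L_*` at `p.1.1` in the direction `p.1.2`, with the
parameter `p.2`. -/
noncomputable def outgoing {k : ℕ} (p : Phase k × ℝ) : Space k × Space k :=
  lineAt (Plane.incl p.1.1) (HalfSphere.vec p.1.2) p.2

theorem measurable_outgoing {k : ℕ} : Measurable (outgoing (k := k)) := by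
  have h1 : Measurable fun p : Phase k × ℝ => Plane.incl p.1.1 :=
    measurable_incl.comp (measurable_fst.comp measurable_fst)
  have h2 : Measurable fun p : Phase k × ℝ => HalfSphere.vec p.1.2 :=
    measurable_vec.comp (measurable_snd.comp measurable_fst)
  unfold outgoing lineAt
  fun_prop

theorem outgoing_injective {k : ℕ} : Function.Injective (outgoing (k := k)) := by
  rintro ⟨⟨x, v⟩, t⟩ ⟨⟨x', v'⟩, t'⟩ h
  obtain ⟨h1, h2⟩ := Prod.ext_iff.1 h
  obtain rfl : v = v' := vec_injective h2
  change Plane.incl x + (t - inner ℝ (Plane.incl x) (HalfSphere.vec v)) • HalfSphere.vec v =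
    Plane.incl x' + (t' - inner ℝ (Plane.incl x') (HalfSphere.vec v)) • HalfSphere.vec v at h1
  have hh := congrArg height h1
  have hv : height (HalfSphere.vec v) ≠ 0 := v.2.ne'
  rw [height_add, height_add, height_incl, height_incl, height_smul, height_smul, zero_add,
    zero_add, mul_left_inj' hv] at hh
  rw [hh] at h1
  have hx : x = x' := incl_injective (add_right_cancel h1)
  subst hx
  have ht : t = t' := sub_left_injective hh
  rw [ht]

theorem measurable_flux (k : ℕ) : Measurable fun v : HalfSphere k =>
    ENNReal.ofReal (knudsenConst k * height (HalfSphere.vec v)) :=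
  ((continuous_height_vec k).measurable.const_mul _).ennreal_ofReal

theorem lintegral_sphereMeasure_eq {k : ℕ} {f : Space k → ENNReal} (hf : Measurable f)
    (hf0 : ∀ u, height u ≤ 0 → f u = 0) :
    ∫⁻ u, f u ∂(sphereMeasure k) = ∫⁻ v, f (HalfSphere.vec v) ∂(surfaceMeasure k) := by
  have he : MeasurableEmbedding (Subtype.val : HalfSphere k → Metric.sphere (0 : Space k) 1) :=
    MeasurableEmbedding.subtype_coe (measurableSet_halfSphere k)
  have h1 : ∫⁻ v, f (HalfSphere.vec v) ∂(surfaceMeasure k) =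
      ∫⁻ v in {v : Metric.sphere (0 : Space k) 1 | 0 < height (v : Space k)}, f v
        ∂((volume : Measure (Space k)).toSphere) := by
    rw [← map_comap_subtype_coe (measurableSet_halfSphere k)]
    exact (he.lintegral_map fun v : Metric.sphere (0 : Space k) 1 => f v).symm
  rw [h1, sphereMeasure, lintegral_map hf measurable_subtype_coe,
    ← lintegral_indicator (measurableSet_halfSphere k)]
  refine lintegral_congr fun v => ?_
  by_cases hv : 0 < height (v : Space k)
  · rw [indicator_of_mem (by exact hv)]
  · rw [indicator_of_notMem (by exact hv), hf0 _ (not_lt.1 hv)]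

/-- Slicing by direction, the flux factor `height v` is exactly the Knudsen density without its
constant. This is the only place where the cosine form of the law matters. -/
theorem Lam_prod_apply {k : ℕ} {C : Set (Phase k × ℝ)} (hC : MeasurableSet C) :
    ((Lam k).prod volume) C =
      ENNReal.ofReal (knudsenConst k) * flowMeasure k (outgoing '' C) := by
  have him : MeasurableSet (outgoing '' C) :=
    hC.image_of_measurable_injOn measurable_outgoing outgoing_injective.injOn
  -- the slice of `C` in the direction `v`
  let Cv : HalfSphere k → Set (Plane k × ℝ) := fun v => {y | ((y.1, v), y.2) ∈ C}
  have hCv : ∀ v, MeasurableSet (Cv v) := fun v =>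
    hC.preimage ((measurable_fst.prodMk measurable_const).prodMk measurable_snd)
  have hslice : ∀ v : HalfSphere k, (fun z => (z, HalfSphere.vec v)) ⁻¹' (outgoing '' C) =
      (fun y : Plane k × ℝ => (lineAt (Plane.incl y.1) (HalfSphere.vec v) y.2).1) '' Cv v := by
    intro v
    ext z
    constructor
    · rintro ⟨⟨⟨x, v'⟩, t⟩, hp, h⟩
      obtain ⟨h1, h2⟩ := Prod.ext_iff.1 h
      obtain rfl : v' = v := vec_injective h2
      exact ⟨(x, t), hp, h1⟩
    · rintro ⟨y, hy, rfl⟩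
      exact ⟨((y.1, v), y.2), hy, rfl⟩
  have hslice0 : ∀ u : Space k, height u ≤ 0 → (fun z => (z, u)) ⁻¹' (outgoing '' C) = ∅ := by
    intro u hu
    refine eq_empty_of_forall_notMem fun z => ?_
    rintro ⟨⟨⟨x, v⟩, t⟩, hp, h⟩
    have h2 : HalfSphere.vec v = u := (Prod.ext_iff.1 h).2
    rw [← h2] at hu
    exact absurd v.2 (not_lt.2 hu)
  have hright : flowMeasure k (outgoing '' C) = ∫⁻ v, ENNReal.ofReal (height (HalfSphere.vec v)) *
      (volume.prod volume) (Cv v) ∂(surfaceMeasure k) := by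
    rw [flowMeasure, Measure.prod_apply_symm him, lintegral_sphereMeasure_eq
      (measurable_measure_prodMk_right him) (fun u hu => by rw [hslice0 u hu, measure_empty])]
    refine lintegral_congr fun v => ?_
    rw [hslice v]
    exact volume_image_lineAt_incl (v := HalfSphere.vec v) v.2 (hCv v)
  have hvol : ∀ v, ∫⁻ x : Plane k, volume (Prod.mk (x, v) ⁻¹' C) = (volume.prod volume) (Cv v) :=
    fun v => by rw [Measure.prod_apply (hCv v)]; rfl
  have hm : Measurable fun p : Phase k => volume (Prod.mk p ⁻¹' C) :=
    measurable_measure_prodMk_left hC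
  have hm' : Measurable fun v => (volume.prod volume) (Cv v) := by
    simp_rw [← hvol]
    exact hm.lintegral_prod_left'
  rw [hright, Measure.prod_apply hC, Lam, lintegral_prod_symm _ hm.aemeasurable]
  simp_rw [hvol]
  rw [knudsen, lintegral_withDensity_eq_lintegral_mul _ (measurable_flux k) hm',
    ← lintegral_const_mul (f := fun v => ENNReal.ofReal (height (HalfSphere.vec v)) *
      (volume.prod volume) (Cv v)) _ ((continuous_height_vec k).measurable.ennreal_ofReal.mul hm')]
  refine lintegral_congr fun v => ?_
  rw [Pi.mul_apply, ENNReal.ofReal_mul (p := knudsenConst k)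
    (inv_nonneg.2 (integral_height_pos k).le), mul_assoc]

/-- Reversal of the direction. -/
def flip {k : ℕ} (a : Space k × Space k) : Space k × Space k := (a.1, -a.2)

theorem flip_lineAt {k : ℕ} (z u : Space k) (t : ℝ) :
    flip (lineAt z u t) = lineAt z (-u) (-t) := by
  simp only [flip, lineAt, inner_neg_right, Prod.mk.injEq, and_true]
  module

theorem flip_flip {k : ℕ} (a : Space k × Space k) : flip (flip a) = a := by
  simp [flip]

theorem measurePreserving_flip (k : ℕ) :
    MeasurePreserving (flip (k := k)) (flowMeasure k) (flowMeasure k) :=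
  (MeasurePreserving.id _).prod
    (measurePreserving_sphereMeasure (LinearIsometryEquiv.neg ℝ (E := Space k)))

theorem flowMeasure_image_flip {k : ℕ} {A : Set (Space k × Space k)} (hA : MeasurableSet A) :
    flowMeasure k (flip '' A) = flowMeasure k A := by
  rw [image_eq_preimage_of_inverse flip_flip flip_flip,
    (measurePreserving_flip k).measure_preimage hA.nullMeasurableSet]

/-! ### The reflection map does not increase the measure `Λ` -/

/-- The bound is proved for the product of `Λ` with the line parameter, then the parameter is
integrated out over an interval of length one. -/
theorem Lam_preimage_le {k : ℕ} {M : Set (Space k)} {K : Phase k → Phase k} (hK : Measurable K)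
    (h : IsReflectionMap M K) {A : Set (Phase k)} (hA : MeasurableSet A) :
    Lam k (K ⁻¹' A) ≤ Lam k A := by
  -- The particle enters with velocity `-v`. Reversing a line negates its parameter, which is then
  -- conserved by all reflections.
  let T : Phase k × ℝ → Phase k × ℝ := fun p => (K p.1, -p.2)
  have hT : Measurable T := (hK.comp measurable_fst).prodMk measurable_snd.neg
  let G : Set (Phase k × ℝ) := {p | ReturnsTo M (Plane.incl p.1.1) (-HalfSphere.vec p.1.2)
    (Plane.incl (K p.1).1) (HalfSphere.vec (K p.1).2)}
  have hG : ∀ᵐ p ∂((Lam k).prod volume), p ∈ G :=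
    Measure.quasiMeasurePreserving_fst.ae h
  have hTG : InjOn T G := by
    rintro ⟨⟨x, v⟩, t⟩ hp ⟨⟨x', v'⟩, t'⟩ hp' heq
    obtain ⟨h1, h2⟩ := Prod.ext_iff.1 heq
    change K (x, v) = K (x', v') at h1
    change -t = -t' at h2
    change ReturnsTo M (Plane.incl x) (-HalfSphere.vec v) _ _ at hp
    change ReturnsTo M (Plane.incl x') (-HalfSphere.vec v') _ _ at hp'
    dsimp only at hp hp'
    rw [h1] at hp
    obtain ⟨hx, hv⟩ := hp.injective hp' (height_incl x) (height_incl x')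
    rw [incl_injective hx, vec_injective (neg_injective hv), neg_injective h2]
  have key := measure_preimage_le_of_countablySubpreserving
    (countablySubpreserving_reflects M).reflTransGen (e := outgoing) (j := flip ∘ outgoing)
    measurable_outgoing outgoing_injective
    ((measurePreserving_flip k).measurable.comp measurable_outgoing)
    (c := ENNReal.ofReal (knudsenConst k)) (fun C hC => Lam_prod_apply hC)
    (fun C hC => by
      rw [image_comp, flowMeasure_image_flip
        (hC.image_of_measurable_injOn measurable_outgoing outgoing_injective.injOn)]
      exact Lam_prod_apply hC) hT hG hTG
    (fun p hp => by
      have h1 := ReturnsTo.reflTransGen hp (by rw [norm_neg, norm_vec]) (-p.2)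
      rw [← flip_lineAt] at h1
      exact h1)
    (hA.prod (measurableSet_Icc (a := (-1 : ℝ)) (b := 0)))
  have hpre : T ⁻¹' (A ×ˢ Icc (-1 : ℝ) 0) = (K ⁻¹' A) ×ˢ Icc (0 : ℝ) 1 := by
    ext p
    simp only [T, mem_preimage, mem_prod, mem_Icc, neg_le_neg_iff, Left.neg_nonpos_iff]
    tauto
  rw [hpre, Measure.prod_prod, Measure.prod_prod, Real.volume_Icc, Real.volume_Icc] at key
  simpa using key

/-! ### Weak convergence and open sets -/

theorem liminf_add_liminf_le (u v : ℕ → ENNReal) :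
    liminf u atTop + liminf v atTop ≤ liminf (fun n => u n + v n) atTop := by
  have hmono : ∀ w : ℕ → ENNReal, Monotone fun n => ⨅ i, w (i + n) := fun w n n' h =>
    le_iInf fun i => iInf_le_of_le (i + (n' - n)) (by rw [add_assoc, Nat.sub_add_cancel h])
  simp only [liminf_eq_iSup_iInf_of_nat']
  rw [ENNReal.iSup_add_iSup_of_monotone (hmono u) (hmono v)]
  exact iSup_mono fun n => le_iInf fun i => add_le_add (iInf_le _ i) (iInf_le _ i)

section Portmanteau

variable {Γ : Type*} [MetricSpace Γ] [MeasurableSpace Γ] [BorelSpace Γ]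

/-- A closed subset of an open set, under weak convergence of the restrictions to `A`. -/
theorem measure_closed_le_liminf {μ : ℕ → Measure Γ} {ν : Measure Γ} {A F V : Set Γ}
    (hμ : ∀ n, μ n A < ⊤) (hν : ν A < ⊤)
    (h : ∀ f : BoundedContinuousFunction Γ ℝ,
      Tendsto (fun n => ∫ x, f x ∂((μ n).restrict A)) atTop (𝓝 (∫ x, f x ∂(ν.restrict A))))
    (hF : IsClosed F) (hV : IsOpen V) (hFV : F ⊆ V) (hFA : F ⊆ A) :
    ν F ≤ liminf (fun n => μ n V) atTop := by
  have : ∀ n, IsFiniteMeasure ((μ n).restrict A) := fun n =>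
    ⟨by rw [Measure.restrict_apply_univ]; exact hμ n⟩
  have : IsFiniteMeasure (ν.restrict A) := ⟨by rw [Measure.restrict_apply_univ]; exact hν⟩
  obtain ⟨f, hf0, hf1, hf01⟩ := exists_continuous_zero_one_of_isClosed hV.isClosed_compl hF
    (disjoint_compl_left.mono_right hFV)
  let g : BoundedContinuousFunction Γ ℝ := BoundedContinuousFunction.ofNormedAddCommGroup f
    f.continuous 1 fun x => by
      rw [Real.norm_eq_abs, abs_of_nonneg (hf01 x).1]; exact (hf01 x).2
  have hg : ∀ x, g x = f x := fun x => rfl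
  have hlin : ∀ m : Measure Γ, IsFiniteMeasure m →
      ENNReal.ofReal (∫ x, g x ∂m) = ∫⁻ x, ENNReal.ofReal (g x) ∂m := fun m _ =>
    ofReal_integral_eq_lintegral_ofReal (g.integrable m)
      (Eventually.of_forall fun x => (hf01 x).1)
  have hle : ∀ n, ENNReal.ofReal (∫ x, g x ∂((μ n).restrict A)) ≤ μ n V := by
    intro n
    rw [hlin _ inferInstance]
    calc ∫⁻ x, ENNReal.ofReal (g x) ∂((μ n).restrict A)
        ≤ ∫⁻ x, ENNReal.ofReal (g x) ∂(μ n) := lintegral_mono' Measure.restrict_le_self le_rfl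
      _ ≤ ∫⁻ x, V.indicator 1 x ∂(μ n) := by
          refine lintegral_mono fun x => ?_
          by_cases hx : x ∈ V
          · rw [indicator_of_mem hx, hg]
            exact ENNReal.ofReal_le_one.2 (hf01 x).2
          · rw [hg, hf0 hx]
            simp
      _ = μ n V := lintegral_indicator_one hV.measurableSet
  have hge : ν F ≤ ENNReal.ofReal (∫ x, g x ∂(ν.restrict A)) := by
    rw [hlin _ inferInstance]
    calc ν F = (ν.restrict A) F := by
          rw [Measure.restrict_apply hF.measurableSet, inter_eq_left.2 hFA]
      _ = ∫⁻ x, F.indicator 1 x ∂(ν.restrict A) := (lintegral_indicator_one hF.measurableSet).symm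
      _ ≤ _ := by
          refine lintegral_mono fun x => ?_
          by_cases hx : x ∈ F
          · rw [indicator_of_mem hx, hg, hf1 hx]
            simp
          · rw [indicator_of_notMem hx]
            exact zero_le
  have ht := (ENNReal.continuous_ofReal.tendsto _).comp (h g)
  calc ν F ≤ _ := hge
    _ = liminf (fun n => ENNReal.ofReal (∫ x, g x ∂((μ n).restrict A))) atTop :=
        ht.liminf_eq.symm
    _ ≤ _ := liminf_le_liminf (Eventually.of_forall hle)

/-- Convergence is known on each `A j` separately, and these sets need be neither open nor nested.
Disjoint portions of `V` are approximated from inside by closed sets; disjoint open neighbourhoods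
of these allow the separate lower bounds to be added. -/
theorem measure_inter_accumulate_le_liminf {μ : ℕ → Measure Γ} {ν : Measure Γ} {A : ℕ → Set Γ}
    (hA : ∀ j, MeasurableSet (A j)) (hμ : ∀ j n, μ n (A j) < ⊤) (hν : ∀ j, ν (A j) < ⊤)
    (h : ∀ j, ∀ f : BoundedContinuousFunction Γ ℝ,
      Tendsto (fun n => ∫ x, f x ∂((μ n).restrict (A j))) atTop
        (𝓝 (∫ x, f x ∂(ν.restrict (A j))))) (m : ℕ) :
    ∀ V, IsOpen V → ν (V ∩ ⋃ j < m, A j) ≤ liminf (fun n => μ n V) atTop := by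
  -- inner approximation by closed sets, inside a set of finite measure
  have hinner : ∀ B : Set Γ, MeasurableSet B → ν B < ⊤ → ∀ ε : ENNReal, ε ≠ 0 →
      ∃ F ⊆ B, IsClosed F ∧ ν B ≤ ν F + ε := by
    intro B hB hBfin ε hε
    have : IsFiniteMeasure (ν.restrict B) := ⟨by rwa [Measure.restrict_apply_univ]⟩
    obtain ⟨F, hFB, hF, hεF⟩ := hB.exists_isClosed_lt_add (μ := ν.restrict B)
      (measure_ne_top _ _) hε
    refine ⟨F, hFB, hF, ?_⟩
    rw [Measure.restrict_apply_self, Measure.restrict_apply hF.measurableSet,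
      inter_eq_left.2 hFB] at hεF
    exact hεF.le
  have hUm : ∀ m, MeasurableSet (⋃ j < m, A j) := fun m =>
    MeasurableSet.biUnion (to_countable _) fun j _ => hA j
  have hUfin : ∀ m, ν (⋃ j < m, A j) < ⊤ := fun m =>
    measure_biUnion_lt_top (finite_Iio m) fun j _ => hν j
  induction m with
  | zero => intro V _; simp
  | succ m ih =>
    intro V hV
    have hsplit : V ∩ ⋃ j < m + 1, A j =
        (V ∩ ⋃ j < m, A j) ∪ ((V ∩ A m) \ ⋃ j < m, A j) := by
      rw [biUnion_lt_succ, inter_union_distrib_left]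
      ext x
      simp only [mem_union, mem_inter_iff, Set.mem_sdiff]
      tauto
    have hB₁ : MeasurableSet (V ∩ ⋃ j < m, A j) := hV.measurableSet.inter (hUm m)
    have hB₂ : MeasurableSet ((V ∩ A m) \ ⋃ j < m, A j) :=
      (hV.measurableSet.inter (hA m)).diff (hUm m)
    rw [hsplit, measure_union (disjoint_sdiff_right.mono_left inter_subset_right) hB₂]
    refine ENNReal.le_of_forall_pos_le_add fun ε hε _ => ?_
    have hε2 : (ε : ENNReal) / 2 ≠ 0 := by simpa using hε.ne'
    obtain ⟨F₁, hF₁s, hF₁, ha'⟩ := hinner _ hB₁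
      ((measure_mono inter_subset_right).trans_lt (hUfin m)) _ hε2
    obtain ⟨F₂, hF₂s, hF₂, hb'⟩ := hinner _ hB₂ ((measure_mono
      (sdiff_subset.trans inter_subset_right)).trans_lt (hν m)) _ hε2
    have hdisj : Disjoint F₁ F₂ :=
      disjoint_sdiff_right.mono (hF₁s.trans inter_subset_right) hF₂s
    -- The induction hypothesis is applied to `V ∩ O₁` rather than `V`, which is why it quantifies
    -- over all open sets.
    obtain ⟨O₁, O₂, hO₁, hO₂, hFO₁, hFO₂, hO⟩ := 
      normal_separation hF₁ hF₂ hdisj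
    have h1 : ν F₁ ≤ liminf (fun n => μ n (V ∩ O₁)) atTop := by
      refine (measure_mono ?_).trans (ih (V ∩ O₁) (hV.inter hO₁))
      exact fun x hx => ⟨⟨(hF₁s hx).1, hFO₁ hx⟩, (hF₁s hx).2⟩
    have h2 : ν F₂ ≤ liminf (fun n => μ n (V ∩ O₂)) atTop :=
      measure_closed_le_liminf (hμ m) (hν m) (h m) hF₂ (hV.inter hO₂)
        (fun x hx => ⟨(hF₂s hx).1.1, hFO₂ hx⟩) fun x hx => (hF₂s hx).1.2
    have h3 : ν F₁ + ν F₂ ≤ liminf (fun n => μ n V) atTop := by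
      calc ν F₁ + ν F₂ ≤ liminf (fun n => μ n (V ∩ O₁)) atTop + liminf (fun n => μ n (V ∩ O₂)) atTop :=
            add_le_add h1 h2
        _ ≤ liminf (fun n => μ n (V ∩ O₁) + μ n (V ∩ O₂)) atTop :=
            liminf_add_liminf_le _ _
        _ ≤ liminf (fun n => μ n V) atTop := by
            refine liminf_le_liminf (Eventually.of_forall fun n => ?_)
            rw [← measure_union (hO.mono inter_subset_right inter_subset_right)
              (hV.inter hO₂).measurableSet]
            exact measure_mono (union_subset inter_subset_left inter_subset_left)
    calc ν (V ∩ ⋃ j < m, A j) + ν ((V ∩ A m) \ ⋃ j < m, A j)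
        ≤ (ν F₁ + ε / 2) + (ν F₂ + ε / 2) := add_le_add ha' hb'
      _ = (ν F₁ + ν F₂) + ε := by rw [add_add_add_comm, ENNReal.add_halves]
      _ ≤ _ := add_le_add_left h3 _

theorem ConvergesWeakly.measure_open_le_liminf {μ : ℕ → Measure Γ} {ν : Measure Γ}
    (h : ConvergesWeakly μ ν) {V : Set Γ} (hV : IsOpen V) :
    ν V ≤ liminf (fun n => μ n V) atTop := by
  obtain ⟨A, hA, hcov, hμ, hν, hconv⟩ := h
  have hmono : Monotone fun m => V ∩ ⋃ j < m, A j := fun m m' hm =>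
    inter_subset_inter_right _ (biUnion_subset_biUnion_left fun j hj => lt_of_lt_of_le hj hm)
  have hun : V = ⋃ m, V ∩ ⋃ j < m, A j := by
    refine subset_antisymm (fun x hx => ?_) (iUnion_subset fun m => inter_subset_left)
    obtain ⟨j, hj⟩ := mem_iUnion.1 (hcov ▸ mem_univ x : x ∈ ⋃ j, A j)
    exact mem_iUnion.2 ⟨j + 1, hx, mem_iUnion₂.2 ⟨j, Nat.lt_succ_self j, hj⟩⟩
  conv_lhs => rw [hun]
  rw [hmono.measure_iUnion]
  exact iSup_le fun m => measure_inter_accumulate_le_liminf hA hμ hν hconv m V hV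

end Portmanteau

/-! ### Second marginals of the joint laws -/

instance {k : ℕ} (P : Measure (HalfSphere k)) [IsProbabilityMeasure P] :
    IsMarkovKernel (memorylessKernel P) := by
  unfold memorylessKernel
  infer_instance

theorem compProd_deterministic_univ_prod {k : ℕ} {K : Phase k → Phase k} (hK : Measurable K)
    {C : Set (Phase k)} (hC : MeasurableSet C) :
    (Lam k ⊗ₘ Kernel.deterministic K hK) (univ ×ˢ C) = Lam k (K ⁻¹' C) := by
  rw [Measure.compProd_apply_prod MeasurableSet.univ hC, Measure.restrict_univ,
    ← lintegral_indicator_one (hK hC)]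
  refine lintegral_congr fun p => ?_
  rw [Kernel.deterministic_apply' hK p hC]
  rfl

theorem compProd_memorylessKernel_univ_prod {k : ℕ} (P : Measure (HalfSphere k))
    [IsProbabilityMeasure P] {V : Set (Plane k)} (hV : MeasurableSet V) {U : Set (HalfSphere k)}
    (hU : MeasurableSet U) :
    (Lam k ⊗ₘ memorylessKernel P) (univ ×ˢ (V ×ˢ U)) = volume V * P U := by
  rw [Measure.compProd_apply_prod MeasurableSet.univ (hV.prod hU), Measure.restrict_univ]
  have h1 : ∀ p : Phase k, memorylessKernel P p (V ×ˢ U) =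
      (V ×ˢ (univ : Set (HalfSphere k))).indicator (fun _ => P U) p := by
    intro p
    rw [memorylessKernel, Kernel.prod_apply, Measure.prod_prod, Kernel.const_apply,
      Kernel.deterministic_apply' _ _ hV]
    by_cases hp : p.1 ∈ V
    · rw [indicator_of_mem hp, indicator_of_mem (by exact ⟨hp, mem_univ _⟩), one_mul]
    · rw [indicator_of_notMem hp, indicator_of_notMem (fun h => hp h.1), zero_mul]
  simp_rw [h1]
  rw [lintegral_indicator_const (hV.prod MeasurableSet.univ), Lam, Measure.prod_prod, measure_univ,
    mul_one, mul_comm]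

end RoughReflection

/-! ### Comparison of the limit law with the Knudsen law -/

theorem mainTheorem12 (k : ℕ) (hk : 1 ≤ k)
    (M : ℕ → Set (RoughReflection.Space k))
    (hM : ∀ n, RoughReflection.IsRoughSurface (M n))
    (K : ℕ → RoughReflection.Phase k → RoughReflection.Phase k)
    (hKmeas : ∀ n, Measurable (K n))
    (hK : ∀ n, RoughReflection.IsReflectionMap (M n) (K n))
    (P : Measure (RoughReflection.HalfSphere k)) [IsProbabilityMeasure P]
    (hconv : RoughReflection.ConvergesWeakly
      (fun n => RoughReflection.Lam k ⊗ₘ Kernel.deterministic (K n) (hKmeas n))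
      (RoughReflection.Lam k ⊗ₘ RoughReflection.memorylessKernel P)) :
    P = RoughReflection.knudsen k := by
  have hopen : ∀ U : Set (RoughReflection.HalfSphere k), IsOpen U →
      P U ≤ RoughReflection.knudsen k U := by
    intro U hU
    -- Any open set of positive finite volume would do: its volume is cancelled at the end.
    have hball := Metric.isOpen_ball (x := (0 : RoughReflection.Plane k)) (ε := 1)
    have h1 := hconv.measure_open_le_liminf (isOpen_univ.prod (hball.prod hU))
    rw [RoughReflection.compProd_memorylessKernel_univ_prod P hball.measurableSet
      hU.measurableSet] at h1
    have h2 : liminf (fun n => (RoughReflection.Lam k ⊗ₘ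
        Kernel.deterministic (K n) (hKmeas n)) (univ ×ˢ (Metric.ball 0 1 ×ˢ U))) atTop ≤
        volume (Metric.ball (0 : RoughReflection.Plane k) 1) * RoughReflection.knudsen k U := by
      refine (liminf_le_liminf (Eventually.of_forall fun n => ?_)).trans_eq
        (liminf_const (volume (Metric.ball (0 : RoughReflection.Plane k) 1) *
          RoughReflection.knudsen k U))
      rw [RoughReflection.compProd_deterministic_univ_prod (hKmeas n)
        (hball.measurableSet.prod hU.measurableSet), ← Measure.prod_prod]
      exact RoughReflection.Lam_preimage_le (hKmeas n) (hK n)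
        (hball.measurableSet.prod hU.measurableSet)
    exact (ENNReal.mul_le_mul_iff_right (Metric.measure_ball_pos volume _ one_pos).ne'
      measure_ball_lt_top.ne).1 (h1.trans h2)
  have hle : P ≤ RoughReflection.knudsen k := by
    refine Measure.le_iff.2 fun A _ => ?_
    -- Outer regularity is needed only for the larger measure.
    rw [A.measure_eq_iInf_isOpen (RoughReflection.knudsen k)]
    exact le_iInf₂ fun U hAU => le_iInf fun hU => (measure_mono hAU).trans (hopen U hU)
  exact Measure.eq_of_le_of_isProbabilityMeasure hle
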